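/- Let $G$ be a group with neutral element $e$. **The operad.** Let $\mathsf{PBr}^G$ (parenthesized $G$-braids) be the symmetric $G$-coloured operad in groupoids with the following presentation. *Generating operations* (one for every choice of the input colours): a unit $\eta:()\to e$; an operation $[k]:g\to kgk^{-1}$ for each $k\in G$; a product $\mu:(g,g')\to gg'$. The objects form the free symmetric coloured operad on these operations. *Generating isomorphisms* (for all admissible input colours; the numbers denote inputs): $\alpha:\mu(\mu(1,2),3)\to\mu(1,\mu(2,3))$, $\ell:\mu(\eta,1)\to 1$, $r:\mu(1,\eta)\to 1$, $c:\mu(1,2)\to\mu([a]2,1)$ with $a$ the colour of input $1$, $\beta:\mu([k]1,[k]2)\to[k]\mu(1,2)$, $\gamma:[k][k']1\to[kk']1$, $\delta:[e]1\to 1$, $\varepsilon:[k]\eta\to\eta$. *Relations*: the pentagon for $\alpha$; the triangle for $\alpha,\ell,r$; and, for all $k,k',k''\in G$ and all input colours (with $a_i$ the colour of input $i$; composition is written in diagrammatic order and $\mu(f,f')$, $[k]f$ denote the operations applied to morphisms): * (G1) $\mu(\beta,\mathrm{id})\,\beta\,[k]\alpha=\alpha\,\mu(\mathrm{id},\beta)\,\beta$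 as morphisms $\mu(\mu([k]1,[k]2),[k]3)\to[k]\mu(1,\mu(2,3))$; * (G2) $\mu(\varepsilon,\mathrm{id})\,\ell=\beta\,[k]\ell$ as morphisms $\mu([k]\eta,[k]1)\to[k]1$, and $\mu(\mathrm{id},\varepsilon)\,r=\beta\,[k]r$ as morphisms $\mu([k]1,[k]\eta)\to[k]1$; * (G3) $\gamma=\delta:[e][k]1\to[k]1$ and $\gamma=[k]\delta:[k][e]1\to[k]1$; * (G4) the two morphisms $[k''][k'][k]1\to[k''k'k]1$ built from $\gamma$ agree; * (G5) $\mu(\delta,\delta)=\beta\,\delta:\mu([e]1,[e]2)\to\mu(1,2)$; * (G6) $\varepsilon=\delta:[e]\eta\to\eta$; * (G7) $\mu(\varepsilon,\varepsilon)\,\ell=\beta\,[k]\ell\,\varepsilon:\mu([k]\eta,[k]\eta)\to\eta$; * (G8) $\mu(\gamma,\gamma)\,\beta=\beta\,[k]\beta\,\gamma:\mu([k][k']1,[k][k']2)\to[kk']\mu(1,2)$; * (G9) $\beta\,[k]c\,\beta^{-1}\,\mu(\gamma,\mathrm{id})=c\,\mu(\gamma,\mathrm{id}):\mu([k]1,[k]2)\to\mu([ka_1]2,[k]1)$;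 * (G10) the two hexagons: $c\,\alpha^{-1}=\alpha\,\mu(\mathrm{id},c)\,\alpha^{-1}\,\mu(c,\mathrm{id})\,\mu(\mu(\gamma,\mathrm{id}),\mathrm{id})$ as morphisms $\mu(\mu(1,2),3)\to\mu(\mu([a_1a_2]3,1),2)$, and $c\,\mu(\beta^{-1},\mathrm{id})\,\alpha=\alpha^{-1}\,\mu(c,\mathrm{id})\,\alpha\,\mu(\mathrm{id},c)$ as morphisms $\mu(1,\mu(2,3))\to\mu([a_1]2,\mu([a_1]3,1))$. For $h\in G$ and $\underline g=(g_1,\dots,g_r)\in G^r$, $r\ge 0$, let $\mathsf{PBr}^G\binom{h}{\underline g}$ be the groupoid of operations with input colours $g_1,\dots,g_r$ and output colour $h$. **The action groupoid.** For $(\sigma,\underline b)\in\Sigma_r\times G^r$ and $1\le p\le r$ put $a_p:=b_p\,g_{\sigma^{-1}(p)}\,b_p^{-1}$ (input $i$ is placed at position $\sigma(i)$ and position $p$ is labelled by $b_p$), and let $$\Sigma_r\times_hG^r:=\{(\sigma,\underline b)\in\Sigma_r\times G^r\mid a_1a_2\cdots a_r=h\}.$$ Let $B_r$ be the braid group on $r$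 strands, with generators $c_{j,j+1}$ for $1\le j\le r-1$. The formula $$c_{j,j+1}.(\sigma,\underline b)=\bigl(\tau_{j,j+1}\sigma,\ (b_1,\dots,b_{j-1},\,a_jb_{j+1},\,b_j,\,b_{j+2},\dots,b_r)\bigr),$$ where $\tau_{j,j+1}$ is the transposition of $j$ and $j+1$, defines an action of $B_r$ on $\Sigma_r\times_hG^r$; on the tuples $\underline a$ it is the Hurwitz action $(\dots,a_j,a_{j+1},\dots)\mapsto(\dots,a_ja_{j+1}a_j^{-1},a_j,\dots)$. **Proposition.** For all $h\in G$ and $\underline g\in G^r$ there is an equivalence of groupoids $$\mathsf{PBr}^G\binom{h}{\underline g}\simeq(\Sigma_r\times_hG^r)/\!/B_r .$$ -/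

import Mathlib

open CategoryTheory

universe u v w

namespace GBraid

/-! ### Operations of the `G`-coloured operad of parenthesized `G`-braids

The generating operations are the unit `() → 1`, the operations `[h] : g → h g h⁻¹` and the
products `(g, g') → g g'`, one for every choice of the input colours. -/

/-- Planar trees built from the generating operations, with leaves labelled in `X`.
Once the leaves are coloured there is exactly one way to colour the edges of such a tree by
generating operations, see `GTree.color`; so the colours are not recorded in the tree. -/
inductive GTree (G : Type u) (X : Type v) : Type (max u v)
  | leaf (x : X) : GTree G X
  | unit : GTree G X
  | act (h : G) (t : GTree G X) : GTree G X
  | mul (s t : GTree G X) : GTree G X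

namespace GTree

/-- The colour of the root of a tree whose leaf `x` has colour `g x`. -/
def color {G : Type u} [Group G] {X : Type v} (g : X → G) : GTree G X → G
  | leaf x => g x
  | unit => 1
  | act h t => h * color g t * h⁻¹
  | mul s t => color g s * color g t

/-- The labels of the leaves, from left to right. -/
def leaves {G : Type u} {X : Type v} : GTree G X → List X
  | leaf x => [x]
  | unit => []
  | act _ t => leaves t
  | mul s t => leaves s ++ leaves t

/-- Every label occurs exactly once, i.e. the tree is an operation with one input for every
element of `X`. -/
def IsLinear {G : Type u} {X : Type v} (t : GTree G X) : Prop :=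
  t.leaves.Nodup ∧ ∀ x, x ∈ t.leaves

/-- Operadic composition of operations: graft the tree `t y` onto the leaf `y`. With every `t y`
a leaf, this is the action of the symmetric groups (renumbering of the inputs). -/
def graft {G : Type u} {X : Type v} {Y : Type w} (t : Y → GTree G X) : GTree G Y → GTree G X
  | leaf y => t y
  | unit => unit
  | act h s => act h (graft t s)
  | mul s s' => mul (graft t s) (graft t s')

theorem color_graft {G : Type u} [Group G] {X : Type v} {Y : Type w} {g : X → G} {k : Y → G}
    {t : Y → GTree G X} (ht : ∀ y, (t y).color g = k y) (s : GTree G Y) :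
    (s.graft t).color g = s.color k := by
  induction s with
  | leaf y => exact ht y
  | unit => rfl
  | act h s ih => simp only [graft, color, ih]
  | mul s s' ih ih' => simp only [graft, color, ih, ih']

end GTree

open GTree

/-! ### Morphisms -/

/-- Formal morphisms between trees. They are generated, under composition, inversion and operadic
composition, by the isomorphisms
* `α : μ(μ(1,2),3) → μ(1,μ(2,3))`, `ℓ : μ(η,1) → 1`, `r : μ(1,η) → 1`,
* the braiding `c : μ(1,2) → μ([a]2,1)`, where `a` is the colour of the input `1`,
* `β : μ([h]1,[h]2) → [h]μ(1,2)`, `γ : [k][h]1 → [k h]1`, `δ : [1]1 → 1`, `ε : [h]η → η`.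

Operadic composition enters in two ways: the inputs of a generating isomorphism may be arbitrary
trees, and the generating operations may be applied to morphisms (`actMap`, `mulMap`). -/
inductive PreHom {G : Type u} [Group G] {X : Type v} (g : X → G) :
    GTree G X → GTree G X → Type (max u v)
  | id (s : GTree G X) : PreHom g s s
  | comp {s t u : GTree G X} (f : PreHom g s t) (f' : PreHom g t u) : PreHom g s u
  | inv {s t : GTree G X} (f : PreHom g s t) : PreHom g t s
  | actMap (h : G) {s t : GTree G X} (f : PreHom g s t) : PreHom g (act h s) (act h t)
  | mulMap {s t s' t' : GTree G X} (f : PreHom g s t) (f' : PreHom g s' t') :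
      PreHom g (mul s s') (mul t t')
  | alpha (s t u : GTree G X) : PreHom g (mul (mul s t) u) (mul s (mul t u))
  | ell (s : GTree G X) : PreHom g (mul unit s) s
  | rho (s : GTree G X) : PreHom g (mul s unit) s
  | braid (s t : GTree G X) (a : G) (ha : s.color g = a) : PreHom g (mul s t) (mul (act a t) s)
  | beta (h : G) (s t : GTree G X) : PreHom g (mul (act h s) (act h t)) (act h (mul s t))
  | gamma (k h l : G) (hl : k * h = l) (s : GTree G X) : PreHom g (act k (act h s)) (act l s)
  | delta (s : GTree G X) : PreHom g (act 1 s) s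
  | eps (h : G) : PreHom g (act h unit) unit

infixr:80 " ⋙ₚ " => PreHom.comp

open PreHom

/-- The relations between formal morphisms: the smallest congruence satisfying
* the axioms of a groupoid,
* functoriality of operadic composition, i.e. functoriality of the generating operations and
  naturality of the generating isomorphisms,
* the defining relations (the constructors from `pentagon` on). -/
inductive Rel {G : Type u} [Group G] {X : Type v} (g : X → G) :
    ∀ {s t : GTree G X}, PreHom g s t → PreHom g s t → Prop
  -- congruence
  | refl {s t} (f : PreHom g s t) : Rel g f f
  | symm {s t} {f f' : PreHom g s t} : Rel g f f' → Rel g f' f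
  | trans {s t} {f f' f'' : PreHom g s t} : Rel g f f' → Rel g f' f'' → Rel g f f''
  | comp_congr {s t u} {f f' : PreHom g s t} {k k' : PreHom g t u} :
      Rel g f f' → Rel g k k' → Rel g (f ⋙ₚ k) (f' ⋙ₚ k')
  | inv_congr {s t} {f f' : PreHom g s t} : Rel g f f' → Rel g (inv f) (inv f')
  | act_congr (h : G) {s t} {f f' : PreHom g s t} :
      Rel g f f' → Rel g (.actMap h f) (.actMap h f')
  | mul_congr {s t s' t'} {f f' : PreHom g s t} {k k' : PreHom g s' t'} :
      Rel g f f' → Rel g k k' → Rel g (.mulMap f k) (.mulMap f' k')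
  -- groupoid axioms
  | id_comp {s t} (f : PreHom g s t) : Rel g (.id s ⋙ₚ f) f
  | comp_id {s t} (f : PreHom g s t) : Rel g (f ⋙ₚ .id t) f
  | comp_assoc {s t u v} (f : PreHom g s t) (f' : PreHom g t u) (f'' : PreHom g u v) :
      Rel g ((f ⋙ₚ f') ⋙ₚ f'') (f ⋙ₚ f' ⋙ₚ f'')
  | comp_inv {s t} (f : PreHom g s t) : Rel g (f ⋙ₚ inv f) (.id s)
  | inv_comp {s t} (f : PreHom g s t) : Rel g (inv f ⋙ₚ f) (.id t)
  -- functoriality of the generating operations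
  | act_id (h : G) (s) : Rel g (.actMap h (.id s)) (.id (act h s))
  | act_comp (h : G) {s t u} (f : PreHom g s t) (k : PreHom g t u) :
      Rel g (.actMap h (f ⋙ₚ k)) (.actMap h f ⋙ₚ .actMap h k)
  | mul_id (s t) : Rel g (.mulMap (.id s) (.id t)) (.id (mul s t))
  | mul_comp {s t u s' t' u'} (f : PreHom g s t) (k : PreHom g t u) (f' : PreHom g s' t')
      (k' : PreHom g t' u') :
      Rel g (.mulMap (f ⋙ₚ k) (f' ⋙ₚ k')) (.mulMap f f' ⋙ₚ .mulMap k k')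
  -- naturality of the generating isomorphisms
  | alpha_nat {s t u s' t' u'} (f : PreHom g s s') (f' : PreHom g t t') (f'' : PreHom g u u') :
      Rel g (.mulMap (.mulMap f f') f'' ⋙ₚ alpha s' t' u')
        (alpha s t u ⋙ₚ .mulMap f (.mulMap f' f''))
  | ell_nat {s s'} (f : PreHom g s s') : Rel g (.mulMap (.id unit) f ⋙ₚ ell s') (ell s ⋙ₚ f)
  | rho_nat {s s'} (f : PreHom g s s') : Rel g (.mulMap f (.id unit) ⋙ₚ rho s') (rho s ⋙ₚ f)
  | braid_nat {s t s' t'} (f : PreHom g s s') (f' : PreHom g t t') (a : G) (ha : s.color g = a)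
      (ha' : s'.color g = a) :
      Rel g (.mulMap f f' ⋙ₚ braid s' t' a ha') (braid s t a ha ⋙ₚ .mulMap (.actMap a f') f)
  | beta_nat (h : G) {s t s' t'} (f : PreHom g s s') (f' : PreHom g t t') :
      Rel g (.mulMap (.actMap h f) (.actMap h f') ⋙ₚ beta h s' t')
        (beta h s t ⋙ₚ .actMap h (.mulMap f f'))
  | gamma_nat (k h l : G) (hl : k * h = l) {s s'} (f : PreHom g s s') :
      Rel g (.actMap k (.actMap h f) ⋙ₚ gamma k h l hl s') (gamma k h l hl s ⋙ₚ .actMap l f)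
  | delta_nat {s s'} (f : PreHom g s s') : Rel g (.actMap 1 f ⋙ₚ delta s') (delta s ⋙ₚ f)
  -- pentagon and triangle
  | pentagon (s t u v) :
      Rel g (.mulMap (alpha s t u) (.id v) ⋙ₚ alpha s (mul t u) v ⋙ₚ .mulMap (.id s) (alpha t u v))
        (alpha (mul s t) u v ⋙ₚ alpha s t (mul u v))
  | triangle (s t) :
      Rel g (alpha s unit t ⋙ₚ .mulMap (.id s) (ell t)) (.mulMap (rho s) (.id t))
  -- `[h]` is a monoidal functor
  | G1 (h : G) (s t u) :
      Rel g (.mulMap (beta h s t) (.id (act h u)) ⋙ₚ beta h (mul s t) u ⋙ₚ .actMap h (alpha s t u))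
        (alpha (act h s) (act h t) (act h u) ⋙ₚ .mulMap (.id (act h s)) (beta h t u) ⋙ₚ
          beta h s (mul t u))
  | G2_left (h : G) (s) :
      Rel g (.mulMap (eps h) (.id (act h s)) ⋙ₚ ell (act h s)) (beta h unit s ⋙ₚ .actMap h (ell s))
  | G2_right (h : G) (s) :
      Rel g (.mulMap (.id (act h s)) (eps h) ⋙ₚ rho (act h s)) (beta h s unit ⋙ₚ .actMap h (rho s))
  -- coherence of the action
  | G3_left (h : G) (s) :
      Rel g (gamma 1 h h (one_mul h) s) (delta (act h s))
  | G3_right (h : G) (s) :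
      Rel g (gamma h 1 h (mul_one h) s) (.actMap h (delta s))
  | G4 (h₃ h₂ h₁ k l m : G) (hk : h₃ * h₂ = k) (hl : h₂ * h₁ = l) (hm : k * h₁ = m)
      (hm' : h₃ * l = m) (s) :
      Rel g (gamma h₃ h₂ k hk (act h₁ s) ⋙ₚ gamma k h₁ m hm s)
        (.actMap h₃ (gamma h₂ h₁ l hl s) ⋙ₚ gamma h₃ l m hm' s)
  -- compatibility of the action and the product
  | G5 (s t) : Rel g (.mulMap (delta s) (delta t)) (beta 1 s t ⋙ₚ delta (mul s t))
  | G6 : Rel g (eps 1) (delta unit)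
  | G7 (h : G) :
      Rel g (.mulMap (eps h) (eps h) ⋙ₚ ell unit)
        (beta h unit unit ⋙ₚ .actMap h (ell unit) ⋙ₚ eps h)
  | G8 (k h l : G) (hl : k * h = l) (s t) :
      Rel g (.mulMap (gamma k h l hl s) (gamma k h l hl t) ⋙ₚ beta l s t)
        (beta k (act h s) (act h t) ⋙ₚ .actMap k (beta h s t) ⋙ₚ gamma k h l hl (mul s t))
  -- compatibility of the action and the braiding
  | G9 (h : G) (s t) (a b l : G) (ha : s.color g = a) (hb : (act h s).color g = b)
      (hl : h * a = l) (hl' : b * h = l) :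
      Rel g
        (beta h s t ⋙ₚ .actMap h (braid s t a ha) ⋙ₚ inv (beta h (act a t) s) ⋙ₚ
          .mulMap (gamma h a l hl t) (.id (act h s)))
        (braid (act h s) (act h t) b hb ⋙ₚ .mulMap (gamma b h l hl' t) (.id (act h s)))
  -- hexagons
  | G10_right (s t u) (a b c : G) (ha : s.color g = a) (hb : t.color g = b)
      (hc : (mul s t).color g = c) (hab : a * b = c) :
      Rel g
        (braid (mul s t) u c hc ⋙ₚ inv (alpha (act c u) s t))
        (alpha s t u ⋙ₚ .mulMap (.id s) (braid t u b hb) ⋙ₚ inv (alpha s (act b u) t) ⋙ₚ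
          .mulMap (braid s (act b u) a ha) (.id t) ⋙ₚ
          .mulMap (.mulMap (gamma a b c hab u) (.id s)) (.id t))
  | G10_left (s t u) (a : G) (ha : s.color g = a) :
      Rel g
        (braid s (mul t u) a ha ⋙ₚ .mulMap (inv (beta a t u)) (.id s) ⋙ₚ alpha (act a t) (act a u) s)
        (inv (alpha s t u) ⋙ₚ .mulMap (braid s t a ha) (.id u) ⋙ₚ alpha (act a t) s u ⋙ₚ
          .mulMap (.id (act a t)) (braid s u a ha))

/-! ### Operadic composition of morphisms

The formal morphisms are closed under operadic composition, and operadic composition is a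
well-defined functor modulo the relations. -/

/-- Operadic composition of a morphism with identities on the operations `t y`. -/
def PreHom.graft {G : Type u} [Group G] {X : Type v} {Y : Type w} {g : X → G} {k : Y → G}
    (t : Y → GTree G X) (ht : ∀ y, (t y).color g = k y) {s s' : GTree G Y} :
    PreHom k s s' → PreHom g (s.graft t) (s'.graft t)
  | .id _ => .id _
  | .comp f f' => .comp (f.graft t ht) (f'.graft t ht)
  | .inv f => .inv (f.graft t ht)
  | .actMap h f => .actMap h (f.graft t ht)
  | .mulMap f f' => .mulMap (f.graft t ht) (f'.graft t ht)
  | .alpha _ _ _ => .alpha _ _ _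
  | .ell _ => .ell _
  | .rho _ => .rho _
  | .braid _ _ a ha => .braid _ _ a ((color_graft ht _).trans ha)
  | .beta h _ _ => .beta h _ _
  | .gamma a b l hl _ => .gamma a b l hl _
  | .delta _ => .delta _
  | .eps h => .eps h

/-- Operadic composition of the identity of `s` with morphisms `φ y : t y → t' y`. -/
def PreHom.whisker {G : Type u} [Group G] {X : Type v} {Y : Type w} {g : X → G}
    {t t' : Y → GTree G X} (φ : ∀ y, PreHom g (t y) (t' y)) :
    ∀ s : GTree G Y, PreHom g (s.graft t) (s.graft t')
  | leaf y => φ y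
  | unit => .id _
  | act h s => .actMap h (PreHom.whisker φ s)
  | mul s s' => .mulMap (PreHom.whisker φ s) (PreHom.whisker φ s')

theorem Rel.graft {G : Type u} [Group G] {X : Type v} {Y : Type w} {g : X → G} {k : Y → G}
    (t : Y → GTree G X) (ht : ∀ y, (t y).color g = k y) {s s' : GTree G Y}
    {f f' : PreHom k s s'} (hf : Rel k f f') : Rel g (f.graft t ht) (f'.graft t ht) := by
  induction hf with
  | symm _ ih => exact ih.symm
  | trans _ _ ih ih' => exact ih.trans ih'
  | comp_congr _ _ ih ih' => exact .comp_congr ih ih'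
  | inv_congr _ ih => exact .inv_congr ih
  | act_congr h _ ih => exact .act_congr h ih
  | mul_congr _ _ ih ih' => exact .mul_congr ih ih'
  | refl f => exact .refl _
  | id_comp => exact .id_comp _
  | comp_id => exact .comp_id _
  | comp_assoc => exact .comp_assoc _ _ _
  | comp_inv => exact .comp_inv _
  | inv_comp => exact .inv_comp _
  | act_id => exact .act_id _ _
  | act_comp => exact .act_comp _ _ _
  | mul_id => exact .mul_id _ _
  | mul_comp => exact .mul_comp _ _ _ _
  | alpha_nat => exact .alpha_nat _ _ _
  | ell_nat => exact .ell_nat _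
  | rho_nat => exact .rho_nat _
  | braid_nat => exact .braid_nat _ _ _ _ _
  | beta_nat => exact .beta_nat _ _ _
  | gamma_nat => exact .gamma_nat _ _ _ _ _
  | delta_nat => exact .delta_nat _
  | pentagon => exact .pentagon _ _ _ _
  | triangle => exact .triangle _ _
  | G1 => exact .G1 _ _ _ _
  | G2_left => exact .G2_left _ _
  | G2_right => exact .G2_right _ _
  | G3_left => exact .G3_left _ _
  | G3_right => exact .G3_right _ _
  | G4 => exact .G4 _ _ _ _ _ _ _ _ _ _ _
  | G5 => exact .G5 _ _
  | G6 => exact .G6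
  | G7 => exact .G7 _
  | G8 => exact .G8 _ _ _ _ _ _
  | G9 => exact .G9 _ _ _ _ _ _ _ _ _ _
  | G10_right => exact .G10_right _ _ _ _ _ _ _ _ _ _
  | G10_left => exact .G10_left _ _ _ _ _

theorem Rel.whisker {G : Type u} [Group G] {X : Type v} {Y : Type w} {g : X → G}
    {t t' : Y → GTree G X} {φ φ' : ∀ y, PreHom g (t y) (t' y)} (h : ∀ y, Rel g (φ y) (φ' y))
    (s : GTree G Y) : Rel g (PreHom.whisker φ s) (PreHom.whisker φ' s) := by
  induction s with
  | leaf y => exact h y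
  | unit => exact .refl _
  | act a s ih => exact .act_congr a ih
  | mul s s' ih ih' => exact .mul_congr ih ih'

theorem Rel.whisker_comp {G : Type u} [Group G] {X : Type v} {Y : Type w} {g : X → G}
    {t t' t'' : Y → GTree G X} (φ : ∀ y, PreHom g (t y) (t' y)) (ψ : ∀ y, PreHom g (t' y) (t'' y))
    (s : GTree G Y) :
    Rel g (PreHom.whisker (fun y => φ y ⋙ₚ ψ y) s)
      (PreHom.whisker φ s ⋙ₚ PreHom.whisker ψ s) := by
  induction s with
  | leaf y => exact .refl _
  | unit => exact (Rel.id_comp _).symm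
  | act a s ih => exact (Rel.act_congr a ih).trans (Rel.act_comp a _ _)
  | mul s s' ih ih' => exact (Rel.mul_congr ih ih').trans (Rel.mul_comp _ _ _ _)

/-- Interchange: composing operadically `f` with the family `φ` does not depend on the order. -/
theorem Rel.graft_whisker {G : Type u} [Group G] {X : Type v} {Y : Type w} {g : X → G}
    {k : Y → G} {t t' : Y → GTree G X} (ht : ∀ y, (t y).color g = k y)
    (ht' : ∀ y, (t' y).color g = k y) (φ : ∀ y, PreHom g (t y) (t' y)) {s s' : GTree G Y}
    (f : PreHom k s s') :
    Rel g (PreHom.whisker φ s ⋙ₚ f.graft t' ht') (f.graft t ht ⋙ₚ PreHom.whisker φ s') := by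
  induction f with
  | id s => exact (Rel.comp_id _).trans (Rel.id_comp _).symm
  | comp f f' ih ih' =>
    exact (Rel.comp_assoc _ _ _).symm.trans <| (Rel.comp_congr ih (.refl _)).trans <|
      (Rel.comp_assoc _ _ _).trans <| (Rel.comp_congr (.refl _) ih').trans
        (Rel.comp_assoc _ _ _).symm
  | inv f ih =>
    refine (Rel.id_comp _).symm.trans ?_
    refine (Rel.comp_congr (Rel.inv_comp (f.graft t ht)).symm (.refl _)).trans ?_
    refine (Rel.comp_assoc _ _ _).trans (Rel.comp_congr (.refl _) ?_)
    refine (Rel.comp_assoc _ _ _).symm.trans ?_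
    refine (Rel.comp_congr ih.symm (.refl _)).trans ?_
    refine (Rel.comp_assoc _ _ _).trans ?_
    exact (Rel.comp_congr (.refl _) (Rel.comp_inv _)).trans (Rel.comp_id _)
  | actMap h f ih =>
    exact (Rel.act_comp h _ _).symm.trans ((Rel.act_congr h ih).trans (Rel.act_comp h _ _))
  | mulMap f f' ih ih' =>
    exact (Rel.mul_comp _ _ _ _).symm.trans ((Rel.mul_congr ih ih').trans (Rel.mul_comp _ _ _ _))
  | alpha => exact .alpha_nat _ _ _
  | ell => exact .ell_nat _
  | rho => exact .rho_nat _
  | braid => exact .braid_nat _ _ _ _ _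
  | beta => exact .beta_nat _ _ _
  | gamma => exact .gamma_nat _ _ _ _ _
  | delta => exact .delta_nat _
  | eps h =>
    exact (Rel.comp_congr (Rel.act_id h unit) (.refl (PreHom.eps (g := g) h))).trans
      ((Rel.id_comp _).trans (Rel.comp_id _).symm)

/-! ### The components of the operad -/

/-- An object of the component of the operad with output colour `h` and input colours
`g 0, …, g (r-1)`: a tree whose leaves are numbered bijectively by the inputs. -/
structure PBr {G : Type u} [Group G] {r : ℕ} (h : G) (g : Fin r → G) : Type u where
  tree : GTree G (Fin r)
  color_eq : tree.color g = h
  isLinear : tree.IsLinear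

/-- The component groupoid. -/
instance PBr.instGroupoid {G : Type u} [Group G] {r : ℕ} (h : G) (g : Fin r → G) :
    Groupoid (PBr h g) where
  Hom x y := Quot (Rel g (s := x.tree) (t := y.tree))
  id x := Quot.mk _ (.id x.tree)
  comp {_ _ _} := Quot.map₂ PreHom.comp (fun _ _ _ h => .comp_congr (.refl _) h)
    (fun _ _ _ h => .comp_congr h (.refl _))
  inv {_ _} := Quot.map PreHom.inv (fun _ _ h => .inv_congr h)
  id_comp {_ _} f := Quot.inductionOn f fun _ => Quot.sound (.id_comp _)
  comp_id {_ _} f := Quot.inductionOn f fun _ => Quot.sound (.comp_id _)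
  assoc {_ _ _ _} f f' f'' := Quot.inductionOn f fun _ => Quot.inductionOn f' fun _ =>
    Quot.inductionOn f'' fun _ => Quot.sound (.comp_assoc _ _ _)
  inv_comp {_ _} f := Quot.inductionOn f fun _ => Quot.sound (.inv_comp _)
  comp_inv {_ _} f := Quot.inductionOn f fun _ => Quot.sound (.comp_inv _)

/-! ### The braid group and its action -/

/-- The relations of the braid group: `c_i c_j = c_j c_i` for `|i - j| ≥ 2` and
`c_i c_{i+1} c_i = c_{i+1} c_i c_{i+1}`. -/
inductive BraidRel (r : ℕ) : FreeGroup (Fin (r - 1)) → Prop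
  | far (i j : Fin (r - 1)) (h : (i : ℕ) + 2 ≤ j) :
      BraidRel r (FreeGroup.of i * FreeGroup.of j * (FreeGroup.of j * FreeGroup.of i)⁻¹)
  | braid (i j : Fin (r - 1)) (h : (i : ℕ) + 1 = j) :
      BraidRel r (FreeGroup.of i * FreeGroup.of j * FreeGroup.of i *
        (FreeGroup.of j * FreeGroup.of i * FreeGroup.of j)⁻¹)

/-- The braid group on `r` strands; its generator `j` braids the strands `j` and `j + 1`. -/
abbrev BraidGroup (r : ℕ) : Type := PresentedGroup {w | BraidRel r w}

/-- The position `j` among `r` positions, for a generator `j` of the braid group. -/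
def lo {r : ℕ} (j : Fin (r - 1)) : Fin r := ⟨j, by omega⟩

/-- The position `j + 1` among `r` positions, for a generator `j` of the braid group. -/
def hi {r : ℕ} (j : Fin (r - 1)) : Fin r := ⟨j + 1, by omega⟩

/-- `b_p g_{σ⁻¹(p)} b_p⁻¹`, the colour at the position `p` of the standard operation that places
the input `i` at the position `σ(i)` and labels the position `p` with `b_p`. -/
def posColor {G : Type u} [Group G] {r : ℕ} (g : Fin r → G)
    (x : Equiv.Perm (Fin r) × (Fin r → G)) (p : Fin r) : G :=
  x.2 p * g (x.1⁻¹ p) * (x.2 p)⁻¹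

/-- The set `Σ_r ×_h G^r` of pairs `(σ, b)` for which the product of the elements
`b_p g_{σ⁻¹(p)} b_p⁻¹`, in the order of the positions `p`, is `h`. -/
def SigmaSet {G : Type u} [Group G] {r : ℕ} (h : G) (g : Fin r → G) : Type u :=
  {x : Equiv.Perm (Fin r) × (Fin r → G) // (List.ofFn (posColor g x)).prod = h}

/-- The action of the `j`-th generator of the braid group,
`(σ, b) ↦ (τ_{j,j+1} σ, (…, a_j b_{j+1}, b_j, …))` with `a_j = b_j g_{σ⁻¹(j)} b_j⁻¹`. -/
def braidStep {G : Type u} [Group G] {r : ℕ} (g : Fin r → G) (j : Fin (r - 1))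
    (x : Equiv.Perm (Fin r) × (Fin r → G)) : Equiv.Perm (Fin r) × (Fin r → G) :=
  (Equiv.swap (lo j) (hi j) * x.1,
    fun p => if p = lo j then posColor g x (lo j) * x.2 (hi j)
      else if p = hi j then x.2 (lo j) else x.2 p)

theorem lo_ne_hi {r : ℕ} (j : Fin (r - 1)) : lo j ≠ hi j := by
  simp [lo, hi, Fin.ext_iff]

theorem posColor_braidStep {G : Type u} [Group G] {r : ℕ} (g : Fin r → G) (j : Fin (r - 1))
    (x : Equiv.Perm (Fin r) × (Fin r → G)) (p : Fin r) :
    posColor g (braidStep g j x) p =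
      if p = lo j then posColor g x (lo j) * posColor g x (hi j) * (posColor g x (lo j))⁻¹
      else if p = hi j then posColor g x (lo j) else posColor g x p := by
  have hne := lo_ne_hi j
  by_cases h1 : p = lo j
  · subst h1
    simp [posColor, braidStep, mul_assoc]
  · by_cases h2 : p = hi j
    · subst h2
      simp [posColor, braidStep, hne.symm]
    · simp [posColor, braidStep, h1, h2, Equiv.swap_apply_of_ne_of_ne]

theorem prod_ofFn_eq_of_adjacent {G : Type u} [Group G] : ∀ (r : ℕ) (f f' : Fin r → G) (j : ℕ)
    (hj : j + 1 < r), (∀ p : Fin r, (p : ℕ) ≠ j → (p : ℕ) ≠ j + 1 → f' p = f p) →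
    f' ⟨j, by omega⟩ * f' ⟨j + 1, hj⟩ = f ⟨j, by omega⟩ * f ⟨j + 1, hj⟩ →
    (List.ofFn f').prod = (List.ofFn f).prod
  | 0, _, _, _, hj, _, _ => by omega
  | 1, _, _, _, hj, _, _ => by omega
  | r + 2, f, f', 0, hj, h, h2 => by
      have h3 : (fun i : Fin r => f' i.succ.succ) = fun i => f i.succ.succ := by
        funext i
        exact h _ (by simp) (by simp)
      have h4 : f' 0 * f' (Fin.succ 0) = f 0 * f (Fin.succ 0) := h2
      simp only [List.ofFn_succ, List.prod_cons, ← mul_assoc, h4, h3]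
  | r + 2, f, f', j + 1, hj, h, h2 => by
      have h3 : f' 0 = f 0 := h 0 (by simp) (by simp)
      have h4 := prod_ofFn_eq_of_adjacent (r + 1) (fun i => f i.succ) (fun i => f' i.succ) j
        (by omega) (fun p hp hp' => h _ (by simpa using hp) (by simpa using hp')) h2
      rw [List.ofFn_succ, List.ofFn_succ (f := f), List.prod_cons, List.prod_cons, h3, h4]

theorem prod_posColor_braidStep {G : Type u} [Group G] {r : ℕ} (g : Fin r → G) (j : Fin (r - 1))
    (x : Equiv.Perm (Fin r) × (Fin r → G)) :
    (List.ofFn (posColor g (braidStep g j x))).prod = (List.ofFn (posColor g x)).prod := by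
  have hne := lo_ne_hi j
  refine prod_ofFn_eq_of_adjacent r _ _ j (by omega) (fun p h1 h2 => ?_) ?_
  · rw [posColor_braidStep, if_neg, if_neg]
    · simpa [hi, Fin.ext_iff] using h2
    · simpa [lo, Fin.ext_iff] using h1
  · change posColor g (braidStep g j x) (lo j) * posColor g (braidStep g j x) (hi j) =
      posColor g x (lo j) * posColor g x (hi j)
    rw [posColor_braidStep, posColor_braidStep]
    simp [hne.symm]

/-- The inverse of `braidStep`. -/
def braidStepInv {G : Type u} [Group G] {r : ℕ} (g : Fin r → G) (j : Fin (r - 1))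
    (x : Equiv.Perm (Fin r) × (Fin r → G)) : Equiv.Perm (Fin r) × (Fin r → G) :=
  (Equiv.swap (lo j) (hi j) * x.1,
    fun p => if p = lo j then x.2 (hi j)
      else if p = hi j then (posColor g x (hi j))⁻¹ * x.2 (lo j) else x.2 p)

/-- `braidStep` as a permutation of `Σ_r × G^r`. -/
def braidEquiv {G : Type u} [Group G] {r : ℕ} (g : Fin r → G) (j : Fin (r - 1)) :
    Equiv.Perm (Equiv.Perm (Fin r) × (Fin r → G)) where
  toFun := braidStep g j
  invFun := braidStepInv g j
  left_inv x := by
    have hne := lo_ne_hi j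
    refine Prod.ext ?_ (funext fun p => ?_)
    · simp [braidStep, braidStepInv]
    · simp only [braidStepInv, posColor_braidStep]
      by_cases h1 : p = lo j
      · subst h1; simp [braidStep, hne.symm]
      · by_cases h2 : p = hi j
        · subst h2; simp [braidStep, hne.symm]
        · simp [braidStep, h1, h2]
  right_inv x := by
    have hne := lo_ne_hi j
    refine Prod.ext ?_ (funext fun p => ?_)
    · simp [braidStep, braidStepInv]
    · by_cases h1 : p = lo j
      · subst h1; simp [braidStep, braidStepInv, posColor, hne.symm, mul_assoc]
      · by_cases h2 : p = hi j
        · subst h2; simp [braidStep, braidStepInv, hne.symm]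
        · simp [braidStep, braidStepInv, h1, h2]

/-- The action of the `j`-th generator of the braid group on `Σ_r ×_h G^r`. -/
def braidPerm {G : Type u} [Group G] {r : ℕ} (h : G) (g : Fin r → G) (j : Fin (r - 1)) :
    Equiv.Perm (SigmaSet h g) :=
  (braidEquiv g j).subtypePerm fun x => by
    rw [show braidEquiv g j x = braidStep g j x from rfl, prod_posColor_braidStep]

theorem braidStep_far {G : Type u} [Group G] {r : ℕ} (g : Fin r → G) (i j : Fin (r - 1))
    (hij : (i : ℕ) + 2 ≤ j) (x : Equiv.Perm (Fin r) × (Fin r → G)) :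
    braidStep g i (braidStep g j x) = braidStep g j (braidStep g i x) := by
  have e1 : lo i ≠ lo j := by simp [lo, Fin.ext_iff]; omega
  have e2 : lo i ≠ hi j := by simp [lo, hi, Fin.ext_iff]; omega
  have e3 : hi i ≠ lo j := by simp [lo, hi, Fin.ext_iff]; omega
  have e4 : hi i ≠ hi j := by simp [hi, Fin.ext_iff]; omega
  have ei := lo_ne_hi i
  have ej := lo_ne_hi j
  refine Prod.ext ?_ (funext fun p => ?_)
  · simp only [braidStep, ← mul_assoc]
    congr 1
    refine (Equiv.Perm.Disjoint.commute ?_).eq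
    intro p
    by_cases h1 : p = lo i
    · right; subst h1; exact Equiv.swap_apply_of_ne_of_ne e1 e2
    · by_cases h2 : p = hi i
      · right; subst h2; exact Equiv.swap_apply_of_ne_of_ne e3 e4
      · left; exact Equiv.swap_apply_of_ne_of_ne h1 h2
  · change (if p = lo i then posColor g (braidStep g j x) (lo i) * (braidStep g j x).2 (hi i)
        else if p = hi i then (braidStep g j x).2 (lo i) else (braidStep g j x).2 p) =
      (if p = lo j then posColor g (braidStep g i x) (lo j) * (braidStep g i x).2 (hi j)
        else if p = hi j then (braidStep g i x).2 (lo j) else (braidStep g i x).2 p)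
    simp only [posColor_braidStep, e1, e2, e1.symm, e3.symm, if_false]
    simp only [braidStep, e1, e2, e3, e4, e1.symm, e2.symm, e3.symm, e4.symm, if_false]
    by_cases h1 : p = lo i
    · subst h1; simp [e1, e2]
    · by_cases h2 : p = hi i
      · subst h2; simp [e3, e4]
      · simp [h1, h2]

theorem braidStep_braid {G : Type u} [Group G] {r : ℕ} (g : Fin r → G) (i j : Fin (r - 1))
    (hij : (i : ℕ) + 1 = j) (x : Equiv.Perm (Fin r) × (Fin r → G)) :
    braidStep g i (braidStep g j (braidStep g i x)) =
      braidStep g j (braidStep g i (braidStep g j x)) := by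
  have e1 : hi i = lo j := by simp [lo, hi, Fin.ext_iff]; omega
  have e2 : lo i ≠ hi j := by simp [lo, hi, Fin.ext_iff]; omega
  have ei := lo_ne_hi i
  have ej := lo_ne_hi j
  rw [e1] at ei
  refine Prod.ext ?_ (funext fun p => ?_)
  · simp only [braidStep, ← mul_assoc, e1]
    congr 1
    rw [Equiv.swap_mul_swap_mul_swap ei e2, Equiv.swap_comm (lo i) (lo j),
      Equiv.swap_comm (lo j) (hi j), Equiv.swap_mul_swap_mul_swap ej.symm e2.symm,
      Equiv.swap_comm]
  · have key : ∀ (k : Fin (r - 1)) (y : Equiv.Perm (Fin r) × (Fin r → G)) (q : Fin r),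
        (braidStep g k y).2 q = if q = lo k then posColor g y (lo k) * y.2 (hi k)
          else if q = hi k then y.2 (lo k) else y.2 q := fun _ _ _ => rfl
    simp only [key, posColor_braidStep, e1]
    by_cases h1 : p = lo i
    · subst h1; simp [ei, ei.symm, ej.symm, e2, e2.symm, mul_assoc]
    · by_cases h2 : p = lo j
      · subst h2; simp [ei, ei.symm, ej.symm, e2, e2.symm]
      · by_cases h3 : p = hi j
        · subst h3; simp [ei, ei.symm, ej.symm, e2, e2.symm]
        · simp [h1, h2, h3]

/-- The homomorphism from the braid group to the permutations of `Σ_r ×_h G^r` that sends the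
generator `j` to `braidPerm h g j`. -/
def braidHom {G : Type u} [Group G] {r : ℕ} (h : G) (g : Fin r → G) :
    BraidGroup r →* Equiv.Perm (SigmaSet h g) :=
  PresentedGroup.toGroup (f := braidPerm h g) (by
    rintro w (⟨i, j, hij⟩ | ⟨i, j, hij⟩)
    · simp only [map_mul, map_inv, FreeGroup.lift_apply_of, mul_inv_eq_one]
      exact Equiv.ext fun x => Subtype.ext (braidStep_far g i j hij x.1)
    · simp only [map_mul, map_inv, FreeGroup.lift_apply_of, mul_inv_eq_one]
      exact Equiv.ext fun x => Subtype.ext (braidStep_braid g i j hij x.1))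

/-- The action of the braid group on `Σ_r ×_h G^r`. -/
instance SigmaSet.instMulAction {G : Type u} [Group G] {r : ℕ} (h : G) (g : Fin r → G) :
    MulAction (BraidGroup r) (SigmaSet h g) :=
  MulAction.compHom (SigmaSet h g) (braidHom h g)

theorem of_smul_val {G : Type u} [Group G] {r : ℕ} (h : G) (g : Fin r → G) (j : Fin (r - 1))
    (x : SigmaSet h g) :
    ((PresentedGroup.of j : BraidGroup r) • x).1 = braidStep g j x.1 := by
  change ((braidHom h g (PresentedGroup.of j)) x).1 = _
  rw [braidHom, PresentedGroup.toGroup.of]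
  rfl

end GBraid

/-! The equivalence sends an operation to its normal form and a morphism to its underlying braid.
Pushing all labels `[k]` to the leaves turns a tree into a word of labelled leaves, which for a
linear tree is a point of `SigmaSet`. Reading the braiding of two subtrees as the block braid of
their leaves, and every other generating isomorphism as the trivial braid, gives `PreHom.toBraid`;
the defining relations hold in the braid group (`Rel.toBraid_eq`).

The substance is coherence: a morphism of operations is determined by its braid. Instead of
simplifying formal morphisms, one lets the braid group act. Crossing two adjacent letters of a word
is an isomorphism of trees. Distant crossings commute by interchange, and neighbouring ones satisfy
the Yang-Baxter equation (`swap_yangBaxter`), a consequence of naturality of the braiding, a hexagon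
and G9. So for every tree `o` the group acts on the pairs of a word of length `r` and a morphism
from `o` to the tree of that word (`PointedWord.braidAct`).

The main lemma `isRealized` says that a formal morphism, transported to normal forms, acts on these
pairs as its braid does. It is proved by induction in an arbitrary context: a label `k` on the tree,
a word `u` before it and a word `v` behind it. For the braiding, the hexagons, G9 and naturality cut
both inputs down to labelled leaves, where the braiding is a crossing up to labels; unit inputs are
covered by `braid_unit_left` and `braid_unit_right`, which rest on the hexagons with two unit
inputs.

Now evaluate at the pair of a normal form and its identity. The morphism component shows that equal
braids come from equal morphisms (`rel_of_toBraid_eq`), the word component that the braid carries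
source to target (`toBraid_smul`). Fullness holds because braids are products of crossings and their
inverses, and the isomorphisms to normal forms have trivial braid. Every point of `SigmaSet` is the
normal form of its standard operation. -/

namespace GBraid
open GTree PreHom

open MonoidalCategory

/-! ### The monoidal groupoid of all trees -/

/-- The groupoid of all trees, with the formal morphisms modulo the relations as morphisms. -/
def TreeGroupoid {G : Type u} {X : Type v} (_ : X → G) : Type (max u v) := GTree G X

namespace TreeGroupoid

variable {G : Type u} [Group G] {X : Type v} {g : X → G}

/-- Colour and linearity are not imposed, because subtrees of an operation lie outside its
component. The morphisms are the same quotients as in `PBr`. -/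
instance : Groupoid (TreeGroupoid g) where
  Hom s t := Quot (Rel g (s := s) (t := t))
  id s := Quot.mk _ (.id s)
  comp {_ _ _} := Quot.map₂ PreHom.comp (fun _ _ _ h => .comp_congr (.refl _) h)
    (fun _ _ _ h => .comp_congr h (.refl _))
  inv {_ _} := Quot.map PreHom.inv (fun _ _ h => .inv_congr h)
  id_comp {_ _} f := Quot.inductionOn f fun _ => Quot.sound (.id_comp _)
  comp_id {_ _} f := Quot.inductionOn f fun _ => Quot.sound (.comp_id _)
  assoc {_ _ _ _} f f' f'' := Quot.inductionOn f fun _ => Quot.inductionOn f' fun _ =>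
    Quot.inductionOn f'' fun _ => Quot.sound (.comp_assoc _ _ _)
  inv_comp {_ _} f := Quot.inductionOn f fun _ => Quot.sound (.inv_comp _)
  comp_inv {_ _} f := Quot.inductionOn f fun _ => Quot.sound (.comp_inv _)

/-- The class of a formal morphism. -/
def mk {s t : TreeGroupoid g} (f : PreHom g s t) : s ⟶ t := Quot.mk _ f

/-- `Rel` is already an equivalence relation. This allows passing from an equation in the groupoid
back to `Rel`, and so to an equality of braids. -/
theorem mk_eq_iff {s t : TreeGroupoid g} {f f' : PreHom g s t} : mk f = mk f' ↔ Rel g f f' := by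
  refine ⟨fun h => ?_, fun h => Quot.sound h⟩
  have := Quot.eqvGen_exact h
  clear h
  induction this with
  | rel _ _ h => exact h
  | refl _ => exact .refl _
  | symm _ _ _ ih => exact ih.symm
  | trans _ _ _ _ _ ih ih' => exact ih.trans ih'

theorem mk_comp {s t u : TreeGroupoid g} (f : PreHom g s t) (f' : PreHom g t u) :
    mk (PreHom.comp f f') = mk f ≫ mk f' := rfl

theorem mk_inv {s t : TreeGroupoid g} (f : PreHom g s t) :
    mk (PreHom.inv f) = CategoryTheory.inv (mk f) := by
  rw [← Groupoid.inv_eq_inv]; rfl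

/-- The product of morphisms. -/
def tensor {s t s' t' : TreeGroupoid g} (f : s ⟶ t) (f' : s' ⟶ t') :
    Quiver.Hom (V := TreeGroupoid g) (GTree.mul s s') (GTree.mul t t') :=
  Quot.map₂ PreHom.mulMap (fun _ _ _ h => .mul_congr (.refl _) h)
    (fun _ _ _ h => .mul_congr h (.refl _)) f f'

instance : MonoidalCategoryStruct (TreeGroupoid g) where
  tensorObj s t := GTree.mul s t
  whiskerLeft s _ _ f := tensor (𝟙 s) f
  whiskerRight f s := tensor f (𝟙 s)
  tensorHom f f' := tensor f f'
  tensorUnit := GTree.unit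
  associator s t u := ⟨mk (.alpha s t u), mk (.inv (.alpha s t u)),
    Quot.sound (.comp_inv _), Quot.sound (.inv_comp _)⟩
  leftUnitor s := ⟨mk (.ell s), mk (.inv (.ell s)),
    Quot.sound (.comp_inv _), Quot.sound (.inv_comp _)⟩
  rightUnitor s := ⟨mk (.rho s), mk (.inv (.rho s)),
    Quot.sound (.comp_inv _), Quot.sound (.inv_comp _)⟩

instance : MonoidalCategory (TreeGroupoid g) :=
  .ofTensorHom
    (id_tensorHom_id := fun _ _ => Quot.sound (.mul_id _ _))
    (id_tensorHom := fun _ _ _ _ => rfl)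
    (tensorHom_id := fun _ _ => rfl)
    (tensorHom_comp_tensorHom := fun f₁ f₂ g₁ g₂ => Quot.inductionOn f₁ fun _ =>
      Quot.inductionOn f₂ fun _ => Quot.inductionOn g₁ fun _ => Quot.inductionOn g₂ fun _ =>
      (Quot.sound (.mul_comp _ _ _ _)).symm)
    (associator_naturality := fun f₁ f₂ f₃ => Quot.inductionOn f₁ fun _ =>
      Quot.inductionOn f₂ fun _ => Quot.inductionOn f₃ fun _ => Quot.sound (.alpha_nat _ _ _))
    (leftUnitor_naturality := fun f => Quot.inductionOn f fun _ => Quot.sound (.ell_nat _))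
    (rightUnitor_naturality := fun f => Quot.inductionOn f fun _ => Quot.sound (.rho_nat _))
    (pentagon := fun _ _ _ _ => Quot.sound (.pentagon _ _ _ _))
    (triangle := fun _ _ => Quot.sound (.triangle _ _))

/-- The colour of the root. -/
def col (s : TreeGroupoid g) : G := GTree.color g s

/-- The operation `[h]` applied to a tree. -/
def act (h : G) (s : TreeGroupoid g) : TreeGroupoid g := GTree.act h s

/-- The operation `[h]` applied to a morphism. -/
def amap (h : G) {s t : TreeGroupoid g} (f : s ⟶ t) : act h s ⟶ act h t :=
  Quot.map (PreHom.actMap h) (fun _ _ H => .act_congr h H) f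

/-- The braiding. -/
def braid (s t : TreeGroupoid g) (a : G) (ha : s.col = a) : s ⊗ t ⟶ act a t ⊗ s :=
  mk (.braid s t a ha)

/-- The isomorphism `β`. -/
def beta (h : G) (s t : TreeGroupoid g) : act h s ⊗ act h t ⟶ act h (s ⊗ t) :=
  mk (.beta h s t)

/-- The isomorphism `γ`. -/
def gamma (k h l : G) (hl : k * h = l) (s : TreeGroupoid g) : act k (act h s) ⟶ act l s :=
  mk (.gamma k h l hl s)

/-- The isomorphism `δ`. -/
def delta (s : TreeGroupoid g) : act 1 s ⟶ s := mk (.delta s)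

/-- The isomorphism `ε`. -/
def eps (h : G) : act h (𝟙_ (TreeGroupoid g)) ⟶ 𝟙_ (TreeGroupoid g) := mk (.eps h)

variable (s t u : TreeGroupoid g)

@[simp]
theorem amap_id (h : G) : amap h (𝟙 s) = 𝟙 (act h s) := Quot.sound (.act_id h s)

@[simp]
theorem amap_comp (h : G) {s t u : TreeGroupoid g} (f : s ⟶ t) (f' : t ⟶ u) :
    amap h (f ≫ f') = amap h f ≫ amap h f' :=
  Quot.inductionOn f fun _ => Quot.inductionOn f' fun _ => Quot.sound (.act_comp h _ _)

@[simp]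
theorem amap_inv (h : G) {s t : TreeGroupoid g} (f : s ⟶ t) :
    amap h (inv f) = inv (amap h f) := by
  apply IsIso.eq_inv_of_hom_inv_id
  rw [← amap_comp, IsIso.hom_inv_id, amap_id]

theorem braid_nat {s t s' t' : TreeGroupoid g} (f : s ⟶ s') (f' : t ⟶ t') (a : G)
    (ha : s.col = a) (ha' : s'.col = a) :
    (f ⊗ₘ f') ≫ braid s' t' a ha' = braid s t a ha ≫ (amap a f' ⊗ₘ f) :=
  Quot.inductionOn f fun _ => Quot.inductionOn f' fun _ => Quot.sound (.braid_nat _ _ a _ _)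

theorem beta_nat (h : G) {s t s' t' : TreeGroupoid g} (f : s ⟶ s') (f' : t ⟶ t') :
    (amap h f ⊗ₘ amap h f') ≫ beta h s' t' = beta h s t ≫ amap h (f ⊗ₘ f') :=
  Quot.inductionOn f fun _ => Quot.inductionOn f' fun _ => Quot.sound (.beta_nat h _ _)

theorem gamma_nat (k h l : G) (hl : k * h = l) {s s' : TreeGroupoid g} (f : s ⟶ s') :
    amap k (amap h f) ≫ gamma k h l hl s' = gamma k h l hl s ≫ amap l f :=
  Quot.inductionOn f fun _ => Quot.sound (.gamma_nat k h l hl _)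

theorem delta_nat {s s' : TreeGroupoid g} (f : s ⟶ s') :
    amap 1 f ≫ delta s' = delta s ≫ f :=
  Quot.inductionOn f fun _ => Quot.sound (.delta_nat _)

theorem beta_assoc (h : G) :
    beta h s t ▷ act h u ≫ beta h (s ⊗ t) u ≫ amap h (α_ s t u).hom =
      (α_ (act h s) (act h t) (act h u)).hom ≫ act h s ◁ beta h t u ≫ beta h s (t ⊗ u) :=
  Quot.sound (.G1 h s t u)

theorem eps_leftUnitor (h : G) :
    eps h ▷ act h s ≫ (λ_ (act h s)).hom = beta h (𝟙_ _) s ≫ amap h (λ_ s).hom :=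
  Quot.sound (.G2_left h s)

theorem eps_rightUnitor (h : G) :
    act h s ◁ eps h ≫ (ρ_ (act h s)).hom = beta h s (𝟙_ _) ≫ amap h (ρ_ s).hom :=
  Quot.sound (.G2_right h s)

theorem gamma_one_left (h : G) : gamma 1 h h (one_mul h) s = delta (act h s) :=
  Quot.sound (.G3_left h s)

theorem gamma_one_right (h : G) : gamma h 1 h (mul_one h) s = amap h (delta s) :=
  Quot.sound (.G3_right h s)

theorem gamma_gamma (h₃ h₂ h₁ k l m : G) (hk : h₃ * h₂ = k) (hl : h₂ * h₁ = l) (hm : k * h₁ = m)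
    (hm' : h₃ * l = m) :
    gamma h₃ h₂ k hk (act h₁ s) ≫ gamma k h₁ m hm s =
      amap h₃ (gamma h₂ h₁ l hl s) ≫ gamma h₃ l m hm' s :=
  Quot.sound (.G4 _ _ _ _ _ _ _ _ _ _ _)

theorem eps_eps_unitor (h : G) :
    (eps h ⊗ₘ eps h) ≫ (λ_ (𝟙_ (TreeGroupoid g))).hom =
      beta h (𝟙_ _) (𝟙_ _) ≫ amap h (λ_ (𝟙_ (TreeGroupoid g))).hom ≫ eps h :=
  Quot.sound (.G7 h)

theorem gamma_beta (k h l : G) (hl : k * h = l) :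
    (gamma k h l hl s ⊗ₘ gamma k h l hl t) ≫ beta l s t =
      beta k (act h s) (act h t) ≫ amap k (beta h s t) ≫ gamma k h l hl (s ⊗ t) :=
  Quot.sound (.G8 k h l hl s t)

theorem beta_braid (h a b l : G) (ha : s.col = a) (hb : (act h s).col = b) (hl : h * a = l)
    (hl' : b * h = l) :
    beta h s t ≫ amap h (braid s t a ha) ≫ inv (beta h (act a t) s) ≫ gamma h a l hl t ▷ act h s =
      braid (act h s) (act h t) b hb ≫ gamma b h l hl' t ▷ act h s := by
  rw [← Groupoid.inv_eq_inv]
  exact Quot.sound (.G9 h s t a b l ha hb hl hl')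

theorem braid_tensor_left (a b c : G) (ha : s.col = a) (hb : t.col = b)
    (hc : (s ⊗ t).col = c) (hab : a * b = c) :
    braid (s ⊗ t) u c hc ≫ (α_ (act c u) s t).inv =
      (α_ s t u).hom ≫ s ◁ braid t u b hb ≫ (α_ s (act b u) t).inv ≫
        braid s (act b u) a ha ▷ t ≫ gamma a b c hab u ▷ s ▷ t :=
  Quot.sound (.G10_right s t u a b c ha hb hc hab)

theorem braid_tensor_right (a : G) (ha : s.col = a) :
    braid s (t ⊗ u) a ha ≫ inv (beta a t u) ▷ s ≫ (α_ (act a t) (act a u) s).hom =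
      (α_ s t u).inv ≫ braid s t a ha ▷ u ≫ (α_ (act a t) s u).hom ≫
        act a t ◁ braid s u a ha := by
  rw [← Groupoid.inv_eq_inv]
  exact Quot.sound (.G10_left s t u a ha)

@[simp] theorem col_act (h : G) : (act h s).col = h * s.col * h⁻¹ := rfl
@[simp] theorem col_tensor : (s ⊗ t).col = s.col * t.col := rfl
@[simp] theorem col_unit : (𝟙_ (TreeGroupoid g)).col = 1 := rfl

end TreeGroupoid
end GBraid

/-! ### The braiding with the unit -/

namespace GBraid
open GTree PreHom
open MonoidalCategory

/-- The first hexagon with two unit inputs: `e` and `e'` are braidings with the unit stripped of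
unitors, and `d` stands for `γ`. Up to coherence both sides of `H` lie between the same
isomorphisms, which cancel. -/
theorem eq_comp_of_unit_hexagon {C : Type*} [Category* C] [MonoidalCategory C] {u v w : C}
    (e : u ⟶ v) (e' : v ⟶ w) (d : w ⟶ v)
    (H : ((λ_ (𝟙_ C)).hom ▷ u ≫ ((λ_ u).hom ≫ e ≫ (ρ_ v).inv) ≫ v ◁ (λ_ (𝟙_ C)).inv) ≫
        (α_ v (𝟙_ C) (𝟙_ C)).inv =
      (α_ (𝟙_ C) (𝟙_ C) u).hom ≫ 𝟙_ C ◁ ((λ_ u).hom ≫ e ≫ (ρ_ v).inv) ≫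
        (α_ (𝟙_ C) v (𝟙_ C)).inv ≫ ((λ_ v).hom ≫ e' ≫ (ρ_ w).inv) ▷ 𝟙_ C ≫
        d ▷ 𝟙_ C ▷ 𝟙_ C) : e = e ≫ e' ≫ d := by
  have h1 : ((λ_ (𝟙_ C)).hom ▷ u ≫ ((λ_ u).hom ≫ e ≫ (ρ_ v).inv) ≫ v ◁ (λ_ (𝟙_ C)).inv) ≫
        (α_ v (𝟙_ C) (𝟙_ C)).inv =
      ((α_ (𝟙_ C) (𝟙_ C) u).hom ≫ (λ_ _).hom ≫ (λ_ _).hom) ≫ e ≫ (ρ_ v).inv ≫ (ρ_ _).inv := by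
    monoidal
  have h2 : (α_ (𝟙_ C) (𝟙_ C) u).hom ≫ 𝟙_ C ◁ ((λ_ u).hom ≫ e ≫ (ρ_ v).inv) ≫
        (α_ (𝟙_ C) v (𝟙_ C)).inv ≫ ((λ_ v).hom ≫ e' ≫ (ρ_ w).inv) ▷ 𝟙_ C ≫
        d ▷ 𝟙_ C ▷ 𝟙_ C =
      ((α_ (𝟙_ C) (𝟙_ C) u).hom ≫ (λ_ _).hom ≫ (λ_ _).hom) ≫ (e ≫ e' ≫ d) ≫
        (ρ_ v).inv ≫ (ρ_ _).inv := by
    monoidal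
  rw [h1, h2, cancel_epi, cancel_mono] at H
  exact H

/-- The second hexagon with two unit inputs: `i` and `j` stand for `ε` and its inverse, `k` for the
inverse of `β` followed by `[a]` of the unitor, and `hk` is then G7. Idempotence will force `e` to
be the identity. -/
theorem eq_comp_self_of_unit_hexagon {C : Type*} [Category* C] [MonoidalCategory C] {s w : C}
    (e : s ⟶ s) (i : w ⟶ 𝟙_ C) (j : 𝟙_ C ⟶ w) (k : w ⟶ w ⊗ w) (hij : i ≫ j = 𝟙 w)
    (hji : j ≫ i = 𝟙 _)
    (hk : k ≫ (i ⊗ₘ i) ≫ (λ_ (𝟙_ C)).hom = i)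
    (H : (s ◁ (λ_ (𝟙_ C)).hom ≫ ((ρ_ s).hom ≫ e ≫ (λ_ s).inv ≫ j ▷ s) ≫ k ▷ s) ≫
        (α_ w w s).hom =
      (α_ s (𝟙_ C) (𝟙_ C)).inv ≫ ((ρ_ s).hom ≫ e ≫ (λ_ s).inv ≫ j ▷ s) ▷ 𝟙_ C ≫
        (α_ w s (𝟙_ C)).hom ≫ w ◁ ((ρ_ s).hom ≫ e ≫ (λ_ s).inv ≫ j ▷ s)) : e = e ≫ e := by
  have hk' : j ≫ k = (λ_ (𝟙_ C)).inv ≫ (j ⊗ₘ j) := by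
    have : IsIso i := ⟨j, hij, hji⟩
    have e1 : (j ⊗ₘ j) ≫ (i ⊗ₘ i) = 𝟙 _ := by simp [hji]
    have : (i ⊗ₘ i) ≫ (j ⊗ₘ j) = 𝟙 _ := by simp [hij]
    calc j ≫ k = j ≫ (k ≫ (i ⊗ₘ i) ≫ (λ_ (𝟙_ C)).hom) ≫ (λ_ (𝟙_ C)).inv ≫ (j ⊗ₘ j) := by
          simp [this]
      _ = _ := by rw [hk, reassoc_of% hji]
  have h1 : (s ◁ (λ_ (𝟙_ C)).hom ≫ ((ρ_ s).hom ≫ e ≫ (λ_ s).inv ≫ j ▷ s) ≫ k ▷ s) ≫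
        (α_ w w s).hom = ((α_ s (𝟙_ C) (𝟙_ C)).inv ≫ (ρ_ _).hom ≫ (ρ_ _).hom) ≫ e ≫
        (λ_ s).inv ≫ (λ_ _).inv ≫ j ▷ _ ≫ w ◁ j ▷ s := by
    have : (s ◁ (λ_ (𝟙_ C)).hom ≫ ((ρ_ s).hom ≫ e ≫ (λ_ s).inv ≫ j ▷ s) ≫ k ▷ s) ≫
        (α_ w w s).hom = (s ◁ (λ_ (𝟙_ C)).hom ≫ (ρ_ s).hom ≫ e ≫ (λ_ s).inv ≫ (j ≫ k) ▷ s) ≫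
        (α_ w w s).hom := by simp
    rw [this, hk', MonoidalCategory.tensorHom_def]
    monoidal
  have h2 : (α_ s (𝟙_ C) (𝟙_ C)).inv ≫ ((ρ_ s).hom ≫ e ≫ (λ_ s).inv ≫ j ▷ s) ▷ 𝟙_ C ≫
        (α_ w s (𝟙_ C)).hom ≫ w ◁ ((ρ_ s).hom ≫ e ≫ (λ_ s).inv ≫ j ▷ s) =
      ((α_ s (𝟙_ C) (𝟙_ C)).inv ≫ (ρ_ _).hom ≫ (ρ_ _).hom) ≫ (e ≫ e) ≫
        (λ_ s).inv ≫ (λ_ _).inv ≫ j ▷ _ ≫ w ◁ j ▷ s := by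
    have : (α_ s (𝟙_ C) (𝟙_ C)).inv ≫ ((ρ_ s).hom ≫ e ≫ (λ_ s).inv ≫ j ▷ s) ▷ 𝟙_ C ≫
        (α_ w s (𝟙_ C)).hom ≫ w ◁ ((ρ_ s).hom ≫ e ≫ (λ_ s).inv ≫ j ▷ s) =
       (α_ s (𝟙_ C) (𝟙_ C)).inv ≫ ((ρ_ s).hom ≫ e ≫ (λ_ s).inv) ▷ 𝟙_ C ≫
        (α_ _ s (𝟙_ C)).hom ≫ j ▷ _ ≫ w ◁ ((ρ_ s).hom ≫ e ≫ (λ_ s).inv) ≫ w ◁ j ▷ s := by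
      simp
    rw [this, ← whisker_exchange_assoc]
    monoidal
  have hj : IsIso j := ⟨i, hji, hij⟩
  rw [h1, h2, cancel_epi, cancel_mono] at H
  exact H

namespace TreeGroupoid

variable {G : Type u} [Group G] {X : Type v} {g : X → G} (s t u : TreeGroupoid g)

theorem whiskerRight_act_unit_injective (h : G) {s t : TreeGroupoid g} {f f' : s ⟶ t}
    (H : f ▷ act h (𝟙_ _) = f' ▷ act h (𝟙_ _)) : f = f' := by
  rw [← whiskerRight_iff, ← cancel_epi (s ◁ eps h), whisker_exchange, whisker_exchange, H]

/-- A morphism from `act l` of the unit to the unit that satisfies the left half of G2 is unique,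
since whiskering with `act l` of the unit is injective. By G8 and naturality, `γ⁻¹ ≫ [k]ε ≫ ε`
satisfies it as well (`key`). -/
theorem gamma_eps (k h l : G) (hl : k * h = l) :
    gamma k h l hl (𝟙_ (TreeGroupoid g)) ≫ eps l = amap k (eps h) ≫ eps k := by
  rw [← IsIso.eq_inv_comp]
  have key : ∀ s : TreeGroupoid g,
      (inv (gamma k h l hl (𝟙_ (TreeGroupoid g))) ≫ amap k (eps h) ≫ eps k) ▷ act l s ≫
        (λ_ (act l s)).hom = beta l (𝟙_ _) s ≫ amap l (λ_ s).hom := by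
    intro s
    rw [← cancel_epi (gamma k h l hl (𝟙_ (TreeGroupoid g)) ⊗ₘ gamma k h l hl s),
      reassoc_of% gamma_beta, ← gamma_nat, ← reassoc_of% amap_comp, ← eps_leftUnitor,
      tensorHom_def_assoc, whisker_exchange_assoc, leftUnitor_naturality, ← comp_whiskerRight_assoc,
      IsIso.hom_inv_id_assoc]
    have := beta_nat k (eps h) (𝟙 (act h s))
    rw [amap_id, tensorHom_id, tensorHom_id] at this
    rw [reassoc_of% amap_comp, ← reassoc_of% this, ← reassoc_of% eps_leftUnitor, comp_whiskerRight,
      Category.assoc]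
  have H : _ = eps l ▷ act l (𝟙_ _) :=
    (cancel_mono (λ_ (act l (𝟙_ (TreeGroupoid g)))).hom).1
      ((key (𝟙_ _)).trans (eps_leftUnitor (𝟙_ _) l).symm)
  exact (whiskerRight_act_unit_injective l H).symm

/-- The braiding with the unit on the left is trivial. -/
theorem braid_unit_left :
    braid (𝟙_ (TreeGroupoid g)) s 1 rfl =
      (λ_ s).hom ≫ inv (delta s) ≫ (ρ_ (act 1 s)).inv := by
  obtain ⟨e, he⟩ : ∃ e : ∀ u : TreeGroupoid g, u ⟶ act 1 u, ∀ u,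
      braid (𝟙_ (TreeGroupoid g)) u 1 rfl = (λ_ u).hom ≫ e u ≫ (ρ_ (act 1 u)).inv :=
    ⟨fun u => (λ_ u).inv ≫ braid (𝟙_ (TreeGroupoid g)) u 1 rfl ≫ (ρ_ (act 1 u)).hom,
      fun u => by simp⟩
  have hnat : e (act 1 s) ≫ amap 1 (delta s) = delta s ≫ e s := by
    have := braid_nat (𝟙 (𝟙_ (TreeGroupoid g))) (delta s) 1 rfl rfl
    rw [he, he, id_tensorHom, tensorHom_id, leftUnitor_naturality_assoc] at this
    rw [← cancel_mono (ρ_ (act 1 s)).inv, ← cancel_epi (λ_ (act 1 s)).hom, Category.assoc,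
      Category.assoc, this, Category.assoc, Category.assoc, rightUnitor_inv_naturality]
  have H := braid_tensor_left (𝟙_ (TreeGroupoid g)) (𝟙_ _) s 1 1 1 rfl rfl
    (by simp) (one_mul 1)
  have h1 := braid_nat (λ_ (𝟙_ (TreeGroupoid g))).hom (𝟙 s) 1 (by simp) rfl
  rw [amap_id, tensorHom_id, id_tensorHom, ← IsIso.comp_inv_eq, inv_whiskerLeft,
    IsIso.Iso.inv_hom, Category.assoc] at h1
  rw [← h1, he, he] at H
  -- The hexagon says `e s = e s ≫ e (act 1 s) ≫ γ`. Here `γ = δ = [1]δ`, so by `hnat` the last two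
  -- factors are `delta s ≫ e s`.
  have H' := eq_comp_of_unit_hexagon (e s) (e (act 1 s)) _ H
  rw [gamma_one_left] at H'
  have : delta (act 1 s) = amap 1 (delta s) := by
    rw [← cancel_mono (delta s), delta_nat]
  rw [this, hnat] at H'
  have h3 : e s = inv (delta s) := by
    apply IsIso.eq_inv_of_hom_inv_id
    rw [← cancel_epi (e s), ← H', Category.comp_id]
  rw [he, h3]

/-- The braiding with the unit on the right is trivial. -/
theorem braid_unit_right (a : G) (ha : s.col = a) :
    braid s (𝟙_ (TreeGroupoid g)) a ha = (ρ_ s).hom ≫ (λ_ s).inv ≫ inv (eps a) ▷ s := by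
  obtain ⟨e, he⟩ : ∃ e : s ⟶ s,
      braid s (𝟙_ (TreeGroupoid g)) a ha = (ρ_ s).hom ≫ e ≫ (λ_ s).inv ≫ inv (eps a) ▷ s :=
    ⟨(ρ_ s).inv ≫ braid s (𝟙_ (TreeGroupoid g)) a ha ≫ eps a ▷ s ≫ (λ_ s).hom, by
      simp [← comp_whiskerRight]⟩
  have h1 := braid_nat (𝟙 s) (λ_ (𝟙_ (TreeGroupoid g))).hom a ha ha
  rw [tensorHom_id, id_tensorHom, ← IsIso.comp_inv_eq, inv_whiskerRight, Category.assoc] at h1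
  have H := braid_tensor_right s (𝟙_ _) (𝟙_ _) a ha
  have hk := eps_eps_unitor (g := g) a
  rw [← IsIso.inv_comp_eq, ← IsIso.inv_comp_eq] at hk
  rw [← h1, Category.assoc, Category.assoc, ← comp_whiskerRight_assoc, ← Category.assoc,
    ← Category.assoc, he] at H
  have H' := eq_comp_self_of_unit_hexagon e (eps a) (inv (eps a)) _ (by simp) (by simp)
    (by rw [Category.assoc]; exact hk) (by simpa using H)
  -- An invertible idempotent is the identity.
  have h2 : e = 𝟙 s := by rw [← cancel_epi e, ← H', Category.comp_id]
  rw [he, h2, Category.id_comp]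

end TreeGroupoid
end GBraid

namespace GBraid
open GTree PreHom

/-! ### Block braids -/

namespace BraidGroup

variable (r : ℕ)

/-- The `j`-th generator of the braid group on `r` strands, and `1` if there is none. -/
def gen (j : ℕ) : BraidGroup r :=
  if h : j < r - 1 then PresentedGroup.of ⟨j, h⟩ else 1

/-- The braid moving the strand at the position `p` over the next `m` strands. -/
def row (p : ℕ) : ℕ → BraidGroup r
  | 0 => 1
  | m + 1 => gen r (p + m) * row p m

/-- The braid moving the block of `n` strands from the position `p` on over the next `m` strands. -/
def block : ℕ → ℕ → ℕ → BraidGroup r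
  | _, 0, _ => 1
  | p, n + 1, m => row r p m * block (p + 1) n m

/-- The braids involving only the `n` strands from the position `p` on. -/
def supp (p n : ℕ) : Subgroup (BraidGroup r) :=
  Subgroup.closure {x | ∃ j, p ≤ j ∧ j + 1 < p + n ∧ gen r j = x}

variable {r}

/-- No upper bound on the indices is needed, as generators out of range are `1`. -/
theorem gen_far {i j : ℕ} (h : i + 2 ≤ j) : Commute (gen r i) (gen r j) := by
  unfold gen
  split_ifs with h1 h2
  · have := PresentedGroup.one_of_mem (rels := {w | BraidRel r w}) (BraidRel.far ⟨i, h1⟩ ⟨j, h2⟩ h)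
    rw [map_mul, map_inv, mul_inv_eq_one, map_mul, map_mul] at this
    exact this
  all_goals simp

/-- The bound matters: for `j + 2 = r` the factor `gen r (j + 1)` is `1`, and the relation would
force `gen r j = 1`. -/
theorem gen_braid {j : ℕ} (h : j + 2 < r) :
    gen r j * gen r (j + 1) * gen r j = gen r (j + 1) * gen r j * gen r (j + 1) := by
  unfold gen
  rw [dif_pos (by omega), dif_pos (by omega)]
  have := PresentedGroup.one_of_mem (rels := {w | BraidRel r w})
    (BraidRel.braid ⟨j, by omega⟩ ⟨j + 1, by omega⟩ rfl)
  rw [map_mul, map_inv, mul_inv_eq_one, map_mul, map_mul, map_mul, map_mul] at this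
  exact this

theorem gen_mem {p n j : ℕ} (h : p ≤ j) (h' : j + 1 < p + n) : gen r j ∈ supp r p n :=
  Subgroup.subset_closure ⟨j, h, h', rfl⟩

theorem supp_mono {p n p' n' : ℕ} (h : p' ≤ p) (h' : p + n ≤ p' + n') :
    supp r p n ≤ supp r p' n' := by
  rw [supp, Subgroup.closure_le]
  rintro _ ⟨j, h1, h2, rfl⟩
  exact gen_mem (by omega) (by omega)

/-- Disjoint ranges of strands involve generators whose indices differ by at least two. -/
theorem commute_of_mem_supp {p n q m : ℕ} (h : p + n ≤ q) {x y : BraidGroup r}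
    (hx : x ∈ supp r p n) (hy : y ∈ supp r q m) : Commute x y := by
  have : supp r p n ≤ Subgroup.centralizer (supp r q m) := by
    rw [supp, supp, Subgroup.centralizer_closure, Subgroup.closure_le]
    rintro _ ⟨j, h1, h2, rfl⟩
    rw [SetLike.mem_coe, Subgroup.mem_centralizer_iff]
    rintro _ ⟨i, h3, h4, rfl⟩
    exact (gen_far (by omega)).symm
  exact (Subgroup.mem_centralizer_iff.1 (this hx) y hy).symm

theorem row_mem (p m : ℕ) : row r p m ∈ supp r p (m + 1) := by
  induction m with
  | zero => exact one_mem _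
  | succ m ih => exact mul_mem (gen_mem (by omega) (by omega)) (supp_mono le_rfl (by omega) ih)

theorem block_mem (p n m : ℕ) : block r p n m ∈ supp r p (n + m) := by
  induction n generalizing p with
  | zero => exact one_mem _
  | succ n ih =>
    exact mul_mem (supp_mono le_rfl (by omega) (row_mem p m))
      (supp_mono (by omega) (by omega) (ih (p + 1)))

@[simp]
theorem block_zero_left (p m : ℕ) : block r p 0 m = 1 := rfl

@[simp]
theorem block_one_one (p : ℕ) : block r p 1 1 = gen r p := by
  simp [block, row]

theorem row_add (p m m' : ℕ) : row r p (m + m') = row r (p + m) m' * row r p m := by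
  induction m' with
  | zero => simp [row]
  | succ m' ih => rw [← add_assoc, row, row, ih, mul_assoc, add_assoc]

theorem block_add_left (p n n' m : ℕ) :
    block r p (n + n') m = block r p n m * block r (p + n) n' m := by
  induction n generalizing p with
  | zero => simp
  | succ n ih =>
    rw [add_right_comm, block, block, ih, mul_assoc, add_right_comm, add_assoc p n 1]

/-- The row of the first strand over the first `m` others and the block moving the remaining strands
over the last `m'` live on disjoint strands, so they can be reordered. -/
theorem block_add_right (p n m m' : ℕ) :
    block r p n (m + m') = block r (p + m) n m' * block r p n m := by
  induction n generalizing p with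
  | zero => simp
  | succ n ih =>
    have h : Commute (row r p m) (block r (p + 1 + m) n m') :=
      commute_of_mem_supp (by omega) (row_mem p m) (block_mem _ _ _)
    rw [block, block, block, ih, row_add, mul_assoc, ← mul_assoc (row r p m), h.eq, mul_assoc,
      mul_assoc, add_right_comm]

/-- A crossing of two strands that are passed over slides through the row. It commutes with all
factors of the row but two adjacent ones, where the braid relation applies. -/
theorem row_mul_gen {p m j : ℕ} (h : p ≤ j) (h' : j + 1 < p + m) (hr : p + m < r) :
    row r p m * gen r (j + 1) = gen r j * row r p m := by
  induction m with
  | zero => omega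
  | succ m ih =>
    rcases Nat.lt_or_ge (j + 1) (p + m) with h1 | h1
    · rw [row, mul_assoc, ih h1 (by omega), ← mul_assoc, ← mul_assoc, (gen_far (by omega)).symm.eq]
    · obtain ⟨m, rfl⟩ : ∃ k, m = k + 1 := ⟨m - 1, by omega⟩
      obtain rfl : j = p + m := by omega
      have h2 : Commute (row r p m) (gen r (p + m + 1)) :=
        commute_of_mem_supp (q := p + m + 1) (m := 2) (by omega) (row_mem p m)
          (gen_mem le_rfl (by omega))
      rw [row, row, mul_assoc, mul_assoc, h2.eq, ← mul_assoc, ← mul_assoc, ← mul_assoc,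
        ← mul_assoc, ← add_assoc, gen_braid (by omega)]

/-- Two parallel strands moved over `m` others carry their mutual crossing along, at the cost of one
braid relation per strand passed. -/
theorem row_mul_row_mul_gen {p m : ℕ} (hr : p + m + 1 < r) :
    row r p m * row r (p + 1) m * gen r p = gen r (p + m) * (row r p m * row r (p + 1) m) := by
  induction m with
  | zero => simp [row]
  | succ m ih =>
    have h2 : Commute (row r p m) (gen r (p + m + 1)) :=
      commute_of_mem_supp (q := p + m + 1) (m := 2) (by omega) (row_mem p m)
        (gen_mem le_rfl (by omega))
    have h3 : row r p (m + 1) * row r (p + 1) (m + 1) =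
        gen r (p + m) * gen r (p + m + 1) * (row r p m * row r (p + 1) m) := by
      rw [row, row, add_right_comm p 1 m, mul_assoc, ← mul_assoc (row r p m), h2.eq, mul_assoc,
        mul_assoc]
    rw [h3, mul_assoc, ih (by omega), ← mul_assoc, ← mul_assoc, gen_braid (by omega),
      ← add_assoc, mul_assoc, mul_assoc, mul_assoc, mul_assoc]

/-- Naturality of the block braids in the second block. -/
theorem block_mul_gen_right {p n m j : ℕ} (h : p ≤ j) (h' : j + 1 < p + m) (hr : p + n + m ≤ r) :
    block r p n m * gen r (j + n) = gen r j * block r p n m := by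
  induction n generalizing p j with
  | zero => simp
  | succ n ih =>
    rw [block, mul_assoc, add_comm n 1, ← add_assoc j 1 n, ih (by omega) (by omega) (by omega),
      ← mul_assoc, row_mul_gen h h' (by omega), mul_assoc]

/-- Naturality of the block braids in the first block. -/
theorem block_mul_gen_left {p n m j : ℕ} (h : p ≤ j) (h' : j + 1 < p + n) (hr : p + n + m ≤ r) :
    block r p n m * gen r j = gen r (j + m) * block r p n m := by
  induction n generalizing p j with
  | zero => omega
  | succ n ih =>
    rcases Nat.lt_or_ge p j with h1 | h1
    · have h2 : Commute (row r p m) (gen r (j + m)) :=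
        commute_of_mem_supp (q := j + m) (m := 2) (by omega) (row_mem p m)
          (gen_mem le_rfl (by omega))
      rw [block, mul_assoc, ih h1 (by omega) (by omega), ← mul_assoc, h2.eq, mul_assoc]
    · obtain rfl : j = p := by omega
      obtain ⟨n, rfl⟩ : ∃ k, n = k + 1 := ⟨n - 1, by omega⟩
      have h2 : Commute (gen r j) (block r (j + 1 + 1) n m) :=
        commute_of_mem_supp (p := j) (n := 2) (by omega) (gen_mem le_rfl (by omega))
          (block_mem _ _ _)
      rw [block, block, mul_assoc, mul_assoc, ← h2.eq, ← mul_assoc, ← mul_assoc,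
        row_mul_row_mul_gen (by omega), mul_assoc, mul_assoc]

theorem mul_row {p q m : ℕ} {y : BraidGroup r}
    (h : ∀ j, j < m → y * gen r (p + j) = gen r (q + j) * y) :
    y * row r p m = row r q m * y := by
  induction m with
  | zero => simp [row]
  | succ m ih =>
    rw [row, row, ← mul_assoc, h m (by omega), mul_assoc, ih fun j hj => h j (by omega), mul_assoc]

theorem mul_block {p q n m : ℕ} {y : BraidGroup r}
    (h : ∀ j, j + 1 < n + m → y * gen r (p + j) = gen r (q + j) * y) :
    y * block r p n m = block r q n m * y := by
  induction n generalizing p q with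
  | zero => simp
  | succ n ih =>
    rw [block, block, ← mul_assoc, mul_row fun j hj => h j (by omega), mul_assoc,
      ih fun j hj => ?_, mul_assoc]
    rw [add_assoc, add_assoc]
    exact h (1 + j) (by omega)

end BraidGroup

/-! ### The braid of a formal morphism -/

/-- The number of leaves. -/
def GTree.size {G : Type u} {X : Type v} : GTree G X → ℕ
  | leaf _ => 1
  | unit => 0
  | act _ t => size t
  | mul s t => size s + size t

variable {G : Type u} [Group G] {X : Type v} {g : X → G}

theorem PreHom.size_eq {s t : GTree G X} (f : PreHom g s t) : s.size = t.size := by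
  induction f with
  | id => rfl
  | comp _ _ ih ih' => exact ih.trans ih'
  | inv _ ih => exact ih.symm
  | actMap _ _ ih => exact ih
  | mulMap _ _ ih ih' => exact congrArg₂ (· + ·) ih ih'
  | alpha => exact add_assoc _ _ _
  | ell => exact zero_add _
  | rho => rfl
  | braid => exact add_comm _ _
  | beta => rfl
  | gamma => rfl
  | delta => rfl
  | eps => rfl

open BraidGroup

/-- The braid on `r` strands underlying a formal morphism between trees whose leaves are placed at
the positions from `p` on. -/
def PreHom.toBraid (r : ℕ) : ∀ {s t : GTree G X}, ℕ → PreHom g s t → BraidGroup r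
  | _, _, _, .id _ => 1
  -- Later morphisms multiply on the left because the braid group acts from the left.
  | _, _, p, .comp f f' => f'.toBraid r p * f.toBraid r p
  | _, _, p, .inv f => (f.toBraid r p)⁻¹
  | _, _, p, .actMap _ f => f.toBraid r p
  | _, _, p, .mulMap (s := s) f f' => f.toBraid r p * f'.toBraid r (p + s.size)
  | _, _, p, .braid s t _ _ => block r p s.size t.size
  | _, _, _, .alpha _ _ _ => 1
  | _, _, _, .ell _ => 1
  | _, _, _, .rho _ => 1
  | _, _, _, .beta _ _ _ => 1
  | _, _, _, .gamma _ _ _ _ _ => 1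
  | _, _, _, .delta _ => 1
  | _, _, _, .eps _ => 1

variable {r : ℕ}

theorem PreHom.toBraid_mem (p : ℕ) {s t : GTree G X} (f : PreHom g s t) :
    f.toBraid r p ∈ supp r p s.size := by
  induction f generalizing p with
  | comp f f' ih ih' => exact mul_mem (f.size_eq ▸ ih' p) (ih p)
  | inv f ih => exact inv_mem (f.size_eq ▸ ih p)
  | actMap _ f ih => exact ih p
  | mulMap f f' ih ih' =>
    exact mul_mem (supp_mono le_rfl (by simp [GTree.size]) (ih p))
      (supp_mono (by omega) (by simp [GTree.size, add_assoc]) (ih' _))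
  | braid s t => exact block_mem _ _ _
  | _ => exact one_mem _

/-- In the application `y` is a block braid, which shifts the generators inside each of its blocks;
the shift then passes to every braid built from these generators. This gives naturality of the
braiding. -/
theorem PreHom.mul_toBraid {s t : GTree G X} (f : PreHom g s t) {p q : ℕ} {y : BraidGroup r}
    (h : ∀ j, j + 1 < s.size → y * gen r (p + j) = gen r (q + j) * y) :
    y * f.toBraid r p = f.toBraid r q * y := by
  induction f generalizing p q with
  | comp f f' ih ih' =>
    rw [toBraid, toBraid, ← mul_assoc, ih' (f.size_eq ▸ h), mul_assoc, ih h, mul_assoc]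
  | inv f ih =>
    rw [toBraid, toBraid, eq_inv_mul_iff_mul_eq, ← mul_assoc, ← ih (f.size_eq ▸ h),
      mul_inv_cancel_right]
  | actMap _ f ih => exact ih h
  | @mulMap s _ _ _ f f' ih ih' =>
    simp only [GTree.size] at h
    rw [toBraid, toBraid, ← mul_assoc, ih fun j hj => h j (by omega), mul_assoc,
      ih' fun j hj => ?_, mul_assoc]
    rw [add_assoc, add_assoc]
    exact h (s.size + j) (by omega)
  | braid s t => exact mul_block h
  | _ => simp [toBraid]

/-- The relations with content are `mul_comp` (braids on disjoint strands commute), naturality of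
the braiding (block braids shift generators) and the hexagons (block braids are additive in each
block). The bound on positions keeps the braid relation available. -/
theorem Rel.toBraid_eq {s t : GTree G X} {f f' : PreHom g s t} (H : Rel g f f') (p : ℕ)
    (hp : p + s.size ≤ r) : f.toBraid r p = f'.toBraid r p := by
  induction H generalizing p with
  | refl => rfl
  | symm _ ih => exact (ih p hp).symm
  | trans _ _ ih ih' => exact (ih p hp).trans (ih' p hp)
  | @comp_congr _ _ _ f _ _ _ _ _ ih ih' =>
    rw [toBraid, toBraid, ih p hp, ih' p (f.size_eq ▸ hp)]
  | @inv_congr _ _ f _ _ ih => rw [toBraid, toBraid, ih p (f.size_eq ▸ hp)]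
  | act_congr _ _ ih => exact ih p hp
  | mul_congr _ _ ih ih' =>
    simp only [GTree.size] at hp
    rw [toBraid, toBraid, ih p (by omega), ih' _ (by omega)]
  | comp_inv => simp [toBraid]
  | inv_comp => simp [toBraid]
  | @mul_comp s t u s' t' u' f k f' k' =>
    have h : Commute (f.toBraid r p) (k'.toBraid r (p + s.size)) :=
      commute_of_mem_supp le_rfl (f.toBraid_mem p) (k'.toBraid_mem _)
    simp only [toBraid]
    rw [← f.size_eq, mul_assoc, mul_assoc, ← mul_assoc (f.toBraid r p), h.eq, mul_assoc]
  | @braid_nat s t s' t' f f' a _ _ =>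
    simp only [GTree.size] at hp
    simp only [toBraid]
    rw [← f.size_eq, ← f'.size_eq, ← mul_assoc, f.mul_toBraid (q := p + t.size) fun j hj => ?_,
      mul_assoc, f'.mul_toBraid (q := p) fun j hj => ?_, ← mul_assoc]
    · refine congrArg (· * _) (Commute.eq ?_)
      exact (commute_of_mem_supp le_rfl (f'.toBraid_mem p) (f.toBraid_mem _)).symm
    · rw [add_right_comm, block_mul_gen_right (by omega) (by omega) (by omega)]
    · rw [block_mul_gen_left (by omega) (by omega) (by omega), add_right_comm]
  | alpha_nat => simp [toBraid, GTree.size, mul_assoc, add_assoc]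
  | G10_right => simp [toBraid, GTree.size, block_add_left]
  | G10_left => simp [toBraid, GTree.size, block_add_right]
  | _ => simp [toBraid, GTree.size, mul_assoc]

end GBraid

/-! ### The Yang-Baxter equation for labelled inputs -/

namespace GBraid
open GTree PreHom
open MonoidalCategory

section
variable {C : Type*} [Category* C] [MonoidalCategory C]

/-- A morphism exchanging the first two factors of a product of three. -/
def crossTail {a b a' b' : C} (s : a ⊗ b ⟶ b' ⊗ a') (v : C) : a ⊗ (b ⊗ v) ⟶ b' ⊗ (a' ⊗ v) :=
  (α_ a b v).inv ≫ s ▷ v ≫ (α_ b' a' v).hom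

/-- The source of the commutation of distant crossings: `f` will be a crossing further to the right.
-/
theorem crossTail_naturality {a b a' b' : C} (s : a ⊗ b ⟶ b' ⊗ a') {v v' : C} (f : v ⟶ v') :
    a ◁ b ◁ f ≫ crossTail s v' = crossTail s v ≫ b' ◁ a' ◁ f := by
  rw [crossTail, associator_inv_naturality_right_assoc, whisker_exchange_assoc,
    associator_naturality_right, crossTail, Category.assoc, Category.assoc]

/-- Up to reassociation both sides are the two sides of `H` whiskered with the tail `v`. -/
theorem yangBaxter_crossTail {a b d b' d₁ d₁' d₂ : C} (sbd : b ⊗ d ⟶ d₁ ⊗ b)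
    (sad₁ : a ⊗ d₁ ⟶ d₂ ⊗ a) (sab : a ⊗ b ⟶ b' ⊗ a) (sad : a ⊗ d ⟶ d₁' ⊗ a)
    (sbd₁' : b' ⊗ d₁' ⟶ d₂ ⊗ b')
    (H : a ◁ sbd ≫ (α_ _ _ _).inv ≫ sad₁ ▷ b ≫ (α_ _ _ _).hom ≫ d₂ ◁ sab =
      (α_ _ _ _).inv ≫ sab ▷ d ≫ (α_ _ _ _).hom ≫ b' ◁ sad ≫ (α_ _ _ _).inv ≫
        sbd₁' ▷ a ≫ (α_ _ _ _).hom) (v : C) :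
    a ◁ crossTail sbd v ≫ crossTail sad₁ (b ⊗ v) ≫ d₂ ◁ crossTail sab v =
      crossTail sab (d ⊗ v) ≫ b' ◁ crossTail sad v ≫ crossTail sbd₁' (a ⊗ v) := by
  have h1 : a ◁ crossTail sbd v ≫ crossTail sad₁ (b ⊗ v) ≫ d₂ ◁ crossTail sab v =
      (a ◁ (α_ b d v).inv ≫ (α_ a (b ⊗ d) v).inv) ≫
        (a ◁ sbd ≫ (α_ _ _ _).inv ≫ sad₁ ▷ b ≫ (α_ _ _ _).hom ≫ d₂ ◁ sab) ▷ v ≫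
        (α_ _ _ _).hom ≫ d₂ ◁ (α_ _ _ _).hom := by
    simp only [crossTail]
    monoidal
  have h2 : crossTail sab (d ⊗ v) ≫ b' ◁ crossTail sad v ≫ crossTail sbd₁' (a ⊗ v) =
      (a ◁ (α_ b d v).inv ≫ (α_ a (b ⊗ d) v).inv) ≫
        ((α_ _ _ _).inv ≫ sab ▷ d ≫ (α_ _ _ _).hom ≫ b' ◁ sad ≫ (α_ _ _ _).inv ≫
        sbd₁' ▷ a ≫ (α_ _ _ _).hom) ▷ v ≫
        (α_ _ _ _).hom ≫ d₂ ◁ (α_ _ _ _).hom := by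
    simp only [crossTail]
    monoidal
  rw [h1, h2, H]

/-- Interchange moves `f` to the end; `f` and `e` will be `γ`s and `c` a braiding. -/
theorem whiskerRight_whiskerRight_associator {p q z b w w' : C} (f : p ⟶ q) (c : z ⊗ b ⟶ w ⊗ z)
    (e : w ⟶ w') :
    f ▷ z ▷ b ≫ (α_ q z b).hom ≫ q ◁ c ≫ q ◁ e ▷ z =
      (α_ p z b).hom ≫ p ◁ c ≫ (α_ p w z).inv ≫ (p ◁ e) ▷ z ≫ f ▷ w' ▷ z ≫ (α_ q w' z).hom := by
  rw [associator_naturality_left_assoc, ← whisker_exchange_assoc, ← whisker_exchange]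
  monoidal

end

variable {G : Type u} [Group G] {X : Type v} {g : X → G}

namespace TreeGroupoid

/-- The braiding of `s` with `[k]x`, with the labels in front of `x` multiplied. -/
def swap (s x : TreeGroupoid g) (a k l : G) (ha : s.col = a) (hl : a * k = l) :
    s ⊗ act k x ⟶ act l x ⊗ s :=
  braid s (act k x) a ha ≫ gamma a k l hl x ▷ s

/-- G9 turns `[h]` of the braiding into a braiding of `[h]`-images, G4 lets the three labels be
multiplied in either order, and naturality of the braiding absorbs the `γ`s at the source. -/
theorem swap_equivariant (x y : TreeGroupoid g) {h m k l m' k' l' a a' : G}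
    (ha : (act m y).col = a) (ha' : (act m' y).col = a') (hm : h * m = m') (hk : h * k = k')
    (hl : a * k = l) (hl' : a' * k' = l') (hhl : h * l = l') :
    beta h (act m y) (act k x) ≫ amap h (swap (act m y) x a k l ha hl) ≫
        inv (beta h (act l x) (act m y)) ≫ (gamma h l l' hhl x ⊗ₘ gamma h m m' hm y) =
      (gamma h m m' hm y ⊗ₘ gamma h k k' hk x) ≫ swap (act m' y) x a' k' l' ha' hl' := by
  have hb : (act h (act m y)).col = a' := by
    subst hm ha'; simp [mul_assoc]
  have e : a' * h = h * a := by
    rw [← hb, ← ha]; simp [mul_assoc]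
  have h1 : amap h (gamma a k l hl x ▷ act m y) ≫ inv (beta h (act l x) (act m y)) =
      inv (beta h (act a (act k x)) (act m y)) ≫ amap h (gamma a k l hl x) ▷ act h (act m y) := by
    rw [IsIso.eq_inv_comp, ← Category.assoc, IsIso.comp_inv_eq, ← tensorHom_id, ← tensorHom_id,
      ← beta_nat, amap_id]
  have h2 := beta_braid (act m y) (act k x) h a a' (h * a) ha hb rfl e
  have h3 := gamma_gamma x h a k (h * a) l l' rfl hl (by rw [mul_assoc, hl, hhl]) hhl
  have h4 := gamma_gamma x a' h k (h * a) k' l' e hk (by rw [mul_assoc, hl, hhl]) hl'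
  rw [swap, swap, amap_comp, Category.assoc, reassoc_of% h1, whiskerRight_comp_tensorHom, ← h3,
    ← whiskerRight_comp_tensorHom, reassoc_of% h2, whiskerRight_comp_tensorHom, h4,
    reassoc_of% braid_nat, ← tensorHom_comp_whiskerRight]

/-- The Yang-Baxter equation. -/
theorem swap_yangBaxter (z x y : TreeGroupoid g) {m k a b k₁ k₂ m' k' b' : G}
    (ha : z.col = a) (hb : (act m y).col = b) (hb' : (act m' y).col = b')
    (h1 : b * k = k₁) (h2 : a * k₁ = k₂) (h3 : a * m = m') (h4 : a * k = k') (h5 : b' * k' = k₂) :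
    z ◁ swap (act m y) x b k k₁ hb h1 ≫ (α_ _ _ _).inv ≫
        swap z x a k₁ k₂ ha h2 ▷ act m y ≫ (α_ _ _ _).hom ≫ act k₂ x ◁ swap z y a m m' ha h3 =
      (α_ _ _ _).inv ≫ swap z y a m m' ha h3 ▷ act k x ≫ (α_ _ _ _).hom ≫
        act m' y ◁ swap z x a k k' ha h4 ≫ (α_ _ _ _).inv ≫
          swap (act m' y) x b' k' k₂ hb' h5 ▷ z ≫ (α_ _ _ _).hom := by
  -- The equation is naturality of the braiding of `z` with respect to the swap of the other two
  -- inputs: both braidings of `z` are expanded by a hexagon (`B'`), and `[a]` of the swap is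
  -- rewritten by equivariance (`K`).
  have H := braid_nat (𝟙 z) (swap (act m y) x b k k₁ hb h1) a ha ha
  have K := swap_equivariant x y hb hb' h3 h4 h1 h5 h2
  have B := fun t u => braid_tensor_right z t u a ha
  have B' : ∀ t u, braid z (t ⊗ u) a ha = (α_ z t u).inv ≫ braid z t a ha ▷ u ≫
      (α_ (act a t) z u).hom ≫ act a t ◁ braid z u a ha ≫ (α_ (act a t) (act a u) z).inv ≫
        beta a t u ▷ z := by
    intro t u
    rw [← cancel_mono (inv (beta a t u) ▷ z), ← cancel_mono (α_ (act a t) (act a u) z).hom,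
      Category.assoc, B]
    simp [← comp_whiskerRight]
  rw [tensorHom_id, id_tensorHom, B', B', ← cancel_mono (inv (beta a _ _) ▷ z),
    ← cancel_mono ((gamma a k₁ k₂ h2 x ⊗ₘ gamma a m m' h3 y) ▷ z)] at H
  simp only [Category.assoc, ← comp_whiskerRight] at H
  rw [K, IsIso.hom_inv_id_assoc, ← cancel_mono (α_ _ _ _).hom] at H
  simp only [Category.assoc, comp_whiskerRight, tensorHom_def'] at H
  simp only [swap, comp_whiskerRight, MonoidalCategory.whiskerLeft_comp, Category.assoc]
  simp only [swap, comp_whiskerRight, MonoidalCategory.whiskerLeft_comp, Category.assoc] at H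
  rw [whiskerRight_whiskerRight_associator, reassoc_of% whiskerRight_whiskerRight_associator,
    Iso.hom_inv_id_assoc]
  exact H

end TreeGroupoid
end GBraid

namespace GBraid
open GTree PreHom BraidGroup
open MonoidalCategory

/-! ### Words and crossings -/

variable {G : Type u} [Group G] {X : Type v} {g : X → G}

/-- The standard tree with labelled leaves given by a word. -/
def wordTree : List (G × X) → GTree G X
  | [] => unit
  | a :: w => mul (act a.1 (leaf a.2)) (wordTree w)

/-- The colour of a labelled leaf. -/
def letterColor (g : X → G) (a : G × X) : G := a.1 * g a.2 * a.1⁻¹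

/-- The action of the `j`-th generator of the braid group on words. -/
def wordStep (g : X → G) : ℕ → List (G × X) → List (G × X)
  | 0, a :: b :: w => (letterColor g a * b.1, b.2) :: a :: w
  | j + 1, a :: w => a :: wordStep g j w
  -- Words that are too short are fixed, so that every step is a bijection on all words.
  | _, w => w

/-- The inverse of `wordStep`. -/
def wordStepInv (g : X → G) : ℕ → List (G × X) → List (G × X)
  | 0, a :: b :: w => b :: ((letterColor g b)⁻¹ * a.1, a.2) :: w
  | j + 1, a :: w => a :: wordStepInv g j w
  | _, w => w

theorem wordStepInv_wordStep (j : ℕ) (w : List (G × X)) :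
    wordStepInv g j (wordStep g j w) = w := by
  fun_induction wordStep g j w with
  | case1 => simp [wordStepInv]
  | case2 j a w ih => simp [wordStepInv, ih]
  | case3 j w h1 h2 =>
    rcases j with _ | j <;> rcases w with _ | ⟨a, _ | ⟨b, w⟩⟩ <;> simp_all [wordStepInv]

theorem wordStep_wordStepInv (j : ℕ) (w : List (G × X)) :
    wordStep g j (wordStepInv g j w) = w := by
  fun_induction wordStepInv g j w with
  | case1 => simp [wordStep]
  | case2 j a w ih => simp [wordStep, ih]
  | case3 j w h1 h2 =>
    rcases j with _ | j <;> rcases w with _ | ⟨a, _ | ⟨b, w⟩⟩ <;> simp_all [wordStep]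

@[simp]
theorem length_wordStep (j : ℕ) (w : List (G × X)) :
    (wordStep g j w).length = w.length := by
  fun_induction wordStep g j w <;> simp_all

/-- The formal morphism crossing the letters `j` and `j + 1` of a word. -/
def crossing (g : X → G) : ∀ (j : ℕ) (w : List (G × X)),
    PreHom g (wordTree w) (wordTree (wordStep g j w))
  | 0, a :: b :: w =>
    .inv (.alpha _ _ _) ⋙ₚ
      .mulMap (.braid (act a.1 (leaf a.2)) (act b.1 (leaf b.2)) (letterColor g a) rfl ⋙ₚ
        .mulMap (.gamma (letterColor g a) b.1 _ rfl (leaf b.2)) (.id _)) (.id (wordTree w)) ⋙ₚ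
      .alpha _ _ _
  | j + 1, _ :: w => .mulMap (.id _) (crossing g j w)
  | 0, [] => .id _
  | 0, [_] => .id _
  | _ + 1, [] => .id _

@[simp]
theorem size_wordTree {G : Type u} {X : Type v} (w : List (G × X)) :
    (wordTree w).size = w.length := by
  induction w with
  | nil => rfl
  | cons a w ih => simp [wordTree, GTree.size, ih, add_comm]

theorem toBraid_crossing {r : ℕ} (j p : ℕ) (w : List (G × X)) (h : j + 1 < w.length) :
    (crossing g j w).toBraid r p = gen r (p + j) := by
  fun_induction crossing g j w generalizing p with
  | case1 => simp [toBraid, GTree.size]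
  | case2 j a w ih =>
    simp only [List.length_cons, Nat.add_lt_add_iff_right] at h
    simp [toBraid, GTree.size, ih _ h, add_assoc, add_comm 1]
  | _ => simp at h

/-! ### Pointed words and the action of the braid group on them -/

namespace TreeGroupoid

/-- The tree of a word, as an object of the groupoid of trees. -/
def wordObj (g : X → G) (w : List (G × X)) : TreeGroupoid g := wordTree w

/-- A labelled leaf. -/
def letter (g : X → G) (a : G × X) : TreeGroupoid g :=
  TreeGroupoid.act a.1 (GTree.leaf a.2 : GTree G X)

/-- The crossing of two letters. -/
def letterSwap (g : X → G) (a b : G × X) (l : G) (hl : letterColor g a * b.1 = l) :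
    letter g a ⊗ letter g b ⟶ letter g (l, b.2) ⊗ letter g a :=
  swap (letter g a) (GTree.leaf b.2 : GTree G X) (letterColor g a) b.1 l rfl hl

/-- The class of a crossing. -/
def cross (j : ℕ) (w : List (G × X)) : wordObj g w ⟶ wordObj g (wordStep g j w) :=
  mk (crossing g j w)

theorem cross_zero (a b : G × X) (w : List (G × X)) :
    cross (g := g) 0 (a :: b :: w) = crossTail (letterSwap g a b _ rfl) (wordObj g w) := by
  rfl

variable (g) in
/-- A word with a morphism to its tree. -/
structure PointedWord (o : TreeGroupoid g) where
  /-- The word. -/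
  word : List (G × X)
  /-- The morphism to its tree. -/
  hom : o ⟶ wordObj g word

namespace PointedWord

variable {o o' : TreeGroupoid g}

/-- Word and morphism are compared as a pair, so words that agree only propositionally need no
transport of morphisms. This is the case of a common word. -/
theorem mk_congr {w : List (G × X)} {φ φ' : o ⟶ wordObj g w} (h : φ = φ') :
    (⟨w, φ⟩ : PointedWord g o) = ⟨w, φ'⟩ := by rw [h]

theorem hom_eq_of_mk_eq {w : List (G × X)} {φ φ' : o ⟶ wordObj g w}
    (h : (⟨w, φ⟩ : PointedWord g o) = ⟨w, φ'⟩) : φ = φ' := by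
  simpa using h

/-- The action of the generators of the braid group. -/
def step (j : ℕ) (e : PointedWord g o) : PointedWord g o :=
  ⟨wordStep g j e.word, e.hom ≫ cross j e.word⟩

/-- Precomposition. -/
def pre (φ : o ⟶ o') (e : PointedWord g o') : PointedWord g o := ⟨e.word, φ ≫ e.hom⟩

/-- Adding a letter in front. -/
def cons (a : G × X) (e : PointedWord g o) : PointedWord g (letter g a ⊗ o) :=
  ⟨a :: e.word, letter g a ◁ e.hom⟩

theorem step_pre (j : ℕ) (φ : o ⟶ o') (e : PointedWord g o') :
    step j (pre φ e) = pre φ (step j e) :=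
  mk_congr (Category.assoc _ _ _)

theorem step_cons (j : ℕ) (a : G × X) (e : PointedWord g o) :
    step (j + 1) (cons a e) = cons a (step j e) :=
  mk_congr (MonoidalCategory.whiskerLeft_comp (letter g a) e.hom (cross j e.word)).symm

theorem step_step_cons (i j : ℕ) (a : G × X) (e : PointedWord g o) :
    step (i + 1) (step (j + 1) (cons a e)) = cons a (step i (step j e)) := by
  rw [step_cons, step_cons]

/-- Steps commute with precomposition, so identities between steps need checking only on identity
morphisms. -/
theorem eq_pre (e : PointedWord g o) : e = pre e.hom ⟨e.word, 𝟙 _⟩ :=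
  mk_congr (Category.comp_id _).symm

theorem mk_id_cons (a : G × X) (w : List (G × X)) :
    (⟨a :: w, 𝟙 _⟩ : PointedWord g (wordObj g (a :: w))) = cons a ⟨w, 𝟙 (wordObj g w)⟩ :=
  mk_congr (whiskerLeft_id (letter g a) (wordObj g w)).symm

theorem step_bijective (j : ℕ) : Function.Bijective (step (o := o) j) := by
  constructor
  · rintro ⟨w, φ⟩ ⟨w', φ'⟩ h
    obtain rfl : w = w' := by
      have h1 : wordStep g j w = wordStep g j w' := congrArg PointedWord.word h
      rw [← wordStepInv_wordStep (g := g) j w, h1, wordStepInv_wordStep]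
    exact mk_congr ((cancel_mono (cross j w)).1 (hom_eq_of_mk_eq h))
  · rintro ⟨w, φ⟩
    obtain ⟨w, rfl⟩ : ∃ w', wordStep g j w' = w := ⟨_, wordStep_wordStepInv j w⟩
    exact ⟨⟨w, φ ≫ inv (cross j w)⟩, by simp [step]⟩

/-- Peeling off common letters leaves a crossing of the first two letters and a crossing in the
tail, which commute by interchange. Short words are no exception, since steps out of range are
trivial. -/
theorem step_far {i j : ℕ} (h : i + 2 ≤ j) (e : PointedWord g o) :
    step i (step j e) = step j (step i e) := by
  rw [eq_pre e]
  simp only [step_pre]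
  congr 1
  generalize e.word = w
  induction i generalizing j w with
  | zero =>
    obtain ⟨j, rfl⟩ : ∃ k, j = k + 2 := ⟨j - 2, by omega⟩
    rcases w with _ | ⟨a, _ | ⟨b, w⟩⟩
    · rfl
    · refine mk_congr ?_
      change (𝟙 _ ≫ letter g a ◁ 𝟙 (𝟙_ _)) ≫ 𝟙 (letter g a ⊗ 𝟙_ _) =
        (𝟙 _ ≫ 𝟙 (letter g a ⊗ 𝟙_ _)) ≫ letter g a ◁ 𝟙 (𝟙_ _)
      rw [whiskerLeft_id]
    · refine mk_congr ?_
      change (𝟙 _ ≫ cross (j + 2) (a :: b :: w)) ≫ cross 0 (a :: b :: wordStep g j w) =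
        (𝟙 _ ≫ cross 0 (a :: b :: w)) ≫
          cross (j + 2) ((letterColor g a * b.1, b.2) :: a :: w)
      rw [Category.id_comp, Category.id_comp, cross_zero, cross_zero]
      exact crossTail_naturality (letterSwap g a b _ rfl) (cross j w)
  | succ i ih =>
    obtain ⟨j, rfl⟩ : ∃ k, j = k + 1 := ⟨j - 1, by omega⟩
    rcases w with _ | ⟨a, w⟩
    · rfl
    · rw [mk_id_cons]
      exact (step_step_cons i j a _).trans
        ((congrArg (cons a) (ih (j := j) (by omega) w)).trans (step_step_cons j i a _).symm)

/-- Peeling off letters leaves Yang-Baxter for three letters with a tail. On a word of length `j +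
2` the step `j + 1` would be trivial and the relation would fail in general. -/
theorem step_braid (j : ℕ) (e : PointedWord g o) (hj : j + 2 < e.word.length) :
    step j (step (j + 1) (step j e)) = step (j + 1) (step j (step (j + 1) e)) := by
  rw [eq_pre e]
  simp only [step_pre]
  congr 1
  generalize e.word = w at hj
  induction j generalizing w with
  | zero =>
    rcases w with _ | ⟨a, _ | ⟨b, _ | ⟨d, w⟩⟩⟩
    · simp at hj
    · simp at hj
    · simp at hj
    -- The final label of `d` comes out in two forms that agree in `G` but not by definition; as
    -- variables they can be identified before the morphisms are compared.
    · have key : ∀ k₂ k₂' (h : letterColor g a * (letterColor g b * d.1) = k₂)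
          (h' : letterColor g (letterColor g a * b.1, b.2) * (letterColor g a * d.1) = k₂'),
          (⟨(k₂', d.2) :: (letterColor g a * b.1, b.2) :: a :: w,
            crossTail (letterSwap g a b _ rfl) (letter g d ⊗ wordObj g w) ≫
              letter g _ ◁ crossTail (letterSwap g a d _ rfl) (wordObj g w) ≫
              crossTail (letterSwap g (letterColor g a * b.1, b.2)
                (letterColor g a * d.1, d.2) k₂' h') (letter g a ⊗ wordObj g w)⟩ :
              PointedWord g (wordObj g (a :: b :: d :: w))) =
          ⟨(k₂, d.2) :: (letterColor g a * b.1, b.2) :: a :: w,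
            letter g a ◁ crossTail (letterSwap g b d _ rfl) (wordObj g w) ≫
              crossTail (letterSwap g a (letterColor g b * d.1, d.2) k₂ h)
                (letter g b ⊗ wordObj g w) ≫
              letter g (k₂, d.2) ◁ crossTail (letterSwap g a b _ rfl) (wordObj g w)⟩ := by
        intro k₂ k₂' h h'
        obtain rfl : k₂ = k₂' := by
          rw [← h, ← h']; simp [letterColor, mul_assoc]
        refine mk_congr ?_
        exact (yangBaxter_crossTail _ _ _ _ _
          (swap_yangBaxter _ _ _ rfl rfl rfl rfl h rfl rfl h') _).symm
      have comp_three : ∀ {p q t u : TreeGroupoid g} (f : p ⟶ q) (f' : q ⟶ t) (f'' : t ⟶ u),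
          ((𝟙 _ ≫ f) ≫ f') ≫ f'' = f ≫ f' ≫ f'' := by simp
      refine Eq.trans ?_ ((key _ _ rfl rfl).trans ?_)
      · exact mk_congr (comp_three (crossTail (letterSwap g a b _ rfl) (letter g d ⊗ wordObj g w))
          (letter g _ ◁ crossTail (letterSwap g a d _ rfl) (wordObj g w))
          (crossTail (letterSwap g _ _ _ rfl) (letter g a ⊗ wordObj g w)))
      · exact (mk_congr (comp_three (letter g a ◁ crossTail (letterSwap g b d _ rfl) (wordObj g w))
          (crossTail (letterSwap g a _ _ rfl) (letter g b ⊗ wordObj g w))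
          (letter g _ ◁ crossTail (letterSwap g a b _ rfl) (wordObj g w)))).symm
  | succ j ih =>
    rcases w with _ | ⟨a, w⟩
    · simp at hj
    · rw [mk_id_cons]
      have key : ∀ (i j k : ℕ) (e : PointedWord g (wordObj g w)),
          step (i + 1) (step (j + 1) (step (k + 1) (cons a e))) =
            cons a (step i (step j (step k e))) := fun i j k e => by
        rw [step_cons, step_cons, step_cons]
      exact (key j (j + 1) j _).trans ((congrArg (cons a)
        (ih w (by simp at hj; omega))).trans (key (j + 1) j (j + 1) _).symm)

variable (o) in
/-- The permutation of the pointed words of length `r` given by a generator. -/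
noncomputable def stepPerm (r j : ℕ) : Equiv.Perm {e : PointedWord g o // e.word.length = r} :=
  Equiv.Perm.subtypePerm (Equiv.ofBijective _ (step_bijective j)) fun e => by
    simp [step]

variable (o) in
/-- The braid group acts on the pointed words. -/
noncomputable def braidAct (r : ℕ) :
    BraidGroup r →* Equiv.Perm {e : PointedWord g o // e.word.length = r} :=
  PresentedGroup.toGroup (f := fun j : Fin (r - 1) => stepPerm o r j) (by
    rintro w (⟨i, j, hij⟩ | ⟨i, j, hij⟩)
    · simp only [map_mul, map_inv, FreeGroup.lift_apply_of, mul_inv_eq_one]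
      exact Equiv.ext fun x => Subtype.ext (step_far hij x.1)
    · simp only [map_mul, map_inv, FreeGroup.lift_apply_of, mul_inv_eq_one]
      refine Equiv.ext fun x => Subtype.ext ?_
      rw [← hij]
      exact step_braid i x.1 (by have := x.2; omega))

theorem braidAct_gen {r j : ℕ} (h : j + 1 < r) (e : {e : PointedWord g o // e.word.length = r}) :
    (braidAct o r (gen r j) e).1 = step j e.1 := by
  rw [gen, dif_pos (by omega), braidAct, PresentedGroup.toGroup.of]
  rfl

end PointedWord
end TreeGroupoid
end GBraid

namespace GBraid
open GTree PreHom BraidGroup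
open MonoidalCategory

section
theorem inv_id_comp_comp_id {C : Type*} [Category* C] {p q : C} (f : p ⟶ q) :
    inv (𝟙 p) ≫ f ≫ 𝟙 q = f := by
  simp

variable {C : Type*} [Groupoid C] [MonoidalCategory C]

/-- This and the next two lemmas are the unit, label and product cases of
`realizes_lift_whiskerLeft`: they compute the effect on normal forms of a morphism `q` placed behind
a tree. -/
theorem conj_unit {a v v' : C} (e : a ⟶ 𝟙_ C) (q : v ⟶ v') :
    inv (e ▷ v ≫ (λ_ v).hom) ≫ a ◁ q ≫ e ▷ v' ≫ (λ_ v').hom = q := by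
  rw [IsIso.inv_comp_eq, whisker_exchange_assoc, leftUnitor_naturality, Category.assoc]

theorem conj_whiskerRight_comp {a a' v v' n n' : C} (c : a ⟶ a') (q : v ⟶ v') (f : a' ⊗ v ⟶ n)
    (f' : a' ⊗ v' ⟶ n') :
    inv (c ▷ v ≫ f) ≫ a ◁ q ≫ c ▷ v' ≫ f' = inv f ≫ a' ◁ q ≫ f' := by
  rw [IsIso.inv_comp_eq, Category.assoc, IsIso.hom_inv_id_assoc, whisker_exchange_assoc]

theorem conj_tensor {z a b v v' n n' m m' : C} (c : z ⟶ a ⊗ b) (q : v ⟶ v') (f : b ⊗ v ⟶ n)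
    (f' : b ⊗ v' ⟶ n') (e : a ⊗ n ⟶ m) (e' : a ⊗ n' ⟶ m') :
    inv (c ▷ v ≫ (α_ a b v).hom ≫ a ◁ f ≫ e) ≫ z ◁ q ≫ c ▷ v' ≫ (α_ a b v').hom ≫ a ◁ f' ≫ e' =
      inv e ≫ a ◁ (inv f ≫ b ◁ q ≫ f') ≫ e' := by
  rw [IsIso.inv_comp_eq]
  simp only [Category.assoc, IsIso.hom_inv_id_assoc, ← MonoidalCategory.whiskerLeft_comp_assoc,
    whisker_exchange_assoc, associator_naturality_right_assoc]

end

/-! ### Normal forms -/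

/-- The word of the leaves of the tree `[k]t` with their labels, followed by the word `v`. -/
def nfWord {G : Type u} [Group G] {X : Type v} : G → GTree G X → List (G × X) → List (G × X)
  | k, .leaf x, v => (k, x) :: v
  | _, .unit, v => v
  | k, .act h t, v => nfWord (k * h) t v
  | k, .mul s t, v => nfWord k s (nfWord k t v)

/-- The word `w` with the reverse of the word `u` in front. -/
def plug {G : Type u} {X : Type v} : List (G × X) → List (G × X) → List (G × X)
  | [], w => w
  | a :: u, w => plug u (a :: w)

@[simp]
theorem length_plug {G : Type u} {X : Type v} (u w : List (G × X)) :
    (plug u w).length = u.length + w.length := by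
  induction u generalizing w with
  | nil => simp [plug]
  | cons a u ih => simp [plug, ih, add_assoc, add_comm 1]

variable {G : Type u} [Group G] {X : Type v} {g : X → G}

@[simp]
theorem length_nfWord (k : G) (t : GTree G X) (v : List (G × X)) :
    (nfWord k t v).length = t.size + v.length := by
  induction t generalizing k v with
  | leaf => simp [nfWord, GTree.size, add_comm]
  | unit => simp [nfWord, GTree.size]
  | act h t ih => simp [nfWord, GTree.size, ih]
  | mul s t ih ih' => simp [nfWord, GTree.size, ih, ih', add_assoc]

/-- The formal morphism from a tree to its normal form. -/
def nfHom (g : X → G) : ∀ (k : G) (t : GTree G X) (v : List (G × X)),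
    PreHom g (.mul (.act k t) (wordTree v)) (wordTree (nfWord k t v))
  | _, .leaf _, _ => .id _
  | k, .unit, v => .mulMap (.eps k) (.id _) ⋙ₚ .ell (wordTree v)
  | k, .act h t, v => .mulMap (.gamma k h (k * h) rfl t) (.id _) ⋙ₚ nfHom g (k * h) t v
  | k, .mul s t, v => .mulMap (.inv (.beta k s t)) (.id _) ⋙ₚ .alpha _ _ _ ⋙ₚ
      .mulMap (.id _) (nfHom g k t v) ⋙ₚ nfHom g k s (nfWord k t v)

/-- Passing to the normal form never uses the braiding. -/
theorem toBraid_nfHom {r : ℕ} (p : ℕ) (k : G) (t : GTree G X) (v : List (G × X)) :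
    (nfHom g k t v).toBraid r p = 1 := by
  induction t generalizing p k v with
  | leaf => rfl
  | unit => simp [nfHom, toBraid]
  | act h t ih =>
    change (nfHom g (k * h) t v).toBraid r p * (1 * 1) = 1
    rw [ih, mul_one, mul_one]
  | mul s t ih ih' =>
    change (((nfHom g k s (nfWord k t v)).toBraid r p *
      (1 * (nfHom g k t v).toBraid r (p + s.size))) * 1) * (1⁻¹ * 1) = 1
    rw [ih, ih', inv_one, mul_one, mul_one, mul_one, mul_one]

/-! ### Morphisms of normal forms that realize a braid -/

namespace TreeGroupoid

/-- The normal form of `[k]t`, followed by the word `v`. -/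
def normal (k : G) (t : TreeGroupoid g) (v : List (G × X)) : List (G × X) := nfWord k t v

theorem length_normal (k : G) (t : TreeGroupoid g) (v : List (G × X)) :
    (normal k t v).length = GTree.size t + v.length := length_nfWord k t v

/-- The class of `nfHom`. -/
def nf (k : G) (t : TreeGroupoid g) (v : List (G × X)) :
    act k t ⊗ wordObj g v ⟶ wordObj g (normal k t v) := mk (nfHom g k t v)

/-- The effect of a morphism on normal forms. -/
noncomputable def nfMap (k : G) (v : List (G × X)) {s t : TreeGroupoid g} (f : s ⟶ t) :
    wordObj g (normal k s v) ⟶ wordObj g (normal k t v) :=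
  inv (nf k s v) ≫ amap k f ▷ wordObj g v ≫ nf k t v

/-- The effect on the tree of `plug u w` of a morphism from the tree of `w`. -/
def lift : ∀ (u : List (G × X)) {w w' : List (G × X)}, (wordObj g w ⟶ wordObj g w') →
    (wordObj g (plug u w) ⟶ wordObj g (plug u w'))
  | [], _, _, q => q
  | a :: u, w, w', q => lift u (w := a :: w) (w' := a :: w') (letter g a ◁ q)

theorem lift_id (u w : List (G × X)) : lift u (𝟙 (wordObj g w)) = 𝟙 (wordObj g (plug u w)) := by
  induction u generalizing w with
  | nil => rfl
  | cons a u ih =>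
    exact (congrArg (lift u (w := a :: w) (w' := a :: w)) (whiskerLeft_id _ _)).trans (ih (a :: w))

theorem lift_comp (u : List (G × X)) {w w' w'' : List (G × X)} (q : wordObj g w ⟶ wordObj g w')
    (q' : wordObj g w' ⟶ wordObj g w'') : lift u (q ≫ q') = lift u q ≫ lift u q' := by
  induction u generalizing w w' w'' with
  | nil => rfl
  | cons a u ih =>
    exact (congrArg (lift u (w := a :: w) (w' := a :: w''))
      (MonoidalCategory.whiskerLeft_comp _ _ _)).trans
      (ih (w := a :: w) (w' := a :: w') (w'' := a :: w'') (letter g a ◁ q) (letter g a ◁ q'))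

open PointedWord

theorem step_lift (u : List (G × X)) (j : ℕ) (w : List (G × X)) {o : TreeGroupoid g}
    (φ : o ⟶ wordObj g (plug u w)) :
    step (u.length + j) ⟨plug u w, φ⟩ = ⟨plug u (wordStep g j w), φ ≫ lift u (cross j w)⟩ := by
  induction u generalizing j w with
  | nil => rw [List.length_nil, zero_add]; rfl
  | cons a u ih =>
    rw [List.length_cons, add_assoc, add_comm 1]
    exact ih (j + 1) (a :: w) φ

/-- The morphism `q` between trees of words describes the action of the braid `b`. -/
def Realizes {r : ℕ} (b : BraidGroup r) {w w' : List (G × X)} (q : wordObj g w ⟶ wordObj g w') :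
    Prop :=
  ∀ (hw : w.length = r) (o : TreeGroupoid g) (φ : o ⟶ wordObj g w),
    (braidAct o r b ⟨⟨w, φ⟩, hw⟩).1 = ⟨w', φ ≫ q⟩

variable {r : ℕ}

theorem realizes_id (w : List (G × X)) : Realizes (1 : BraidGroup r) (𝟙 (wordObj g w)) := by
  intro hw o φ
  rw [map_one, Category.comp_id]
  rfl

theorem Realizes.comp {b b' : BraidGroup r} {w w' w'' : List (G × X)}
    {q : wordObj g w ⟶ wordObj g w'} {q' : wordObj g w' ⟶ wordObj g w''} (h : Realizes b q)
    (h' : Realizes b' q') : Realizes (b' * b) (q ≫ q') := by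
  intro hw o φ
  have h1 := h hw o φ
  have hw' : w'.length = r := by
    rw [← (braidAct o r b ⟨⟨w, φ⟩, hw⟩).2, h1]
  have h2 : braidAct o r b ⟨⟨w, φ⟩, hw⟩ = ⟨⟨w', φ ≫ q⟩, hw'⟩ := Subtype.ext h1
  rw [map_mul, Equiv.Perm.mul_apply, h2, h' hw', Category.assoc]

theorem Realizes.lift_comp {b b' : BraidGroup r} {u w w' w'' : List (G × X)}
    {q : wordObj g w ⟶ wordObj g w'} {q' : wordObj g w' ⟶ wordObj g w''}
    (h : Realizes b (lift u q)) (h' : Realizes b' (lift u q')) :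
    Realizes (b' * b) (lift u (q ≫ q')) := by
  rw [TreeGroupoid.lift_comp]
  exact h.comp h'

theorem Realizes.inv {b : BraidGroup r} {w w' : List (G × X)}
    {q : wordObj g w ⟶ wordObj g w'} (h : Realizes b q) (hl : w.length = w'.length) :
    Realizes b⁻¹ (CategoryTheory.inv q) := by
  intro hw o φ
  have h1 := h (hl.trans hw) o (φ ≫ CategoryTheory.inv q)
  rw [Category.assoc, IsIso.inv_hom_id, Category.comp_id] at h1
  have h2 : braidAct o r b ⟨⟨w, φ ≫ CategoryTheory.inv q⟩, hl.trans hw⟩ = ⟨⟨w', φ⟩, hw⟩ :=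
    Subtype.ext h1
  rw [map_inv, ← h2, Equiv.Perm.inv_eq_iff_eq.2 rfl]

/-- The hypothesis is an equality of pairs because `w` and `w'` may agree only propositionally;
after substitution `q` is an identity. -/
theorem realizes_one_lift (u : List (G × X)) {w w' : List (G × X)}
    {q : wordObj g w ⟶ wordObj g w'} (h : (⟨w, 𝟙 _⟩ : PointedWord g (wordObj g w)) = ⟨w', q⟩) :
    Realizes (1 : BraidGroup r) (lift u q) := by
  have : ∀ e : PointedWord g (wordObj g w), ⟨w, 𝟙 _⟩ = e →
      Realizes (1 : BraidGroup r) (lift u e.hom) := by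
    rintro _ rfl
    rw [lift_id]
    exact realizes_id _
  exact this _ h

theorem realizes_gen_lift (u : List (G × X)) {w w' : List (G × X)} (hw : 2 ≤ w.length)
    {q : wordObj g w ⟶ wordObj g w'}
    (h : (⟨wordStep g 0 w, cross 0 w⟩ : PointedWord g (wordObj g w)) = ⟨w', q⟩) :
    Realizes (gen r u.length) (lift u q) := by
  have : ∀ e : PointedWord g (wordObj g w), ⟨wordStep g 0 w, cross 0 w⟩ = e →
      Realizes (gen r u.length) (lift u e.hom) := by
    rintro _ rfl hr o φ
    rw [length_plug] at hr
    rw [braidAct_gen (by omega)]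
    exact step_lift u 0 w φ
  exact this _ h

theorem realizes_lift_of_eq {b : BraidGroup r} {u w w' : List (G × X)}
    {q q' : wordObj g w ⟶ wordObj g w'} (h : q = q') (H : Realizes b (lift u q')) :
    Realizes b (lift u q) := h ▸ H

/-- A morphism realizing a braid still does so behind a tree. -/
theorem realizes_lift_whiskerLeft {b : BraidGroup r} {p : ℕ} {w w' : List (G × X)}
    {q : wordObj g w ⟶ wordObj g w'} (h : ∀ u, u.length = p → Realizes b (lift u q))
    (k : G) (s : TreeGroupoid g) (u : List (G × X)) (hu : u.length + GTree.size s = p) :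
    Realizes b (lift u (inv (nf k s w) ≫ act k s ◁ q ≫ nf k s w')) := by
  induction s generalizing k w w' u p with
  | leaf x =>
    -- A labelled leaf is one more letter of the context next to `w`, hence the reversed order in
    -- `plug`.
    exact realizes_lift_of_eq (inv_id_comp_comp_id (letter g (k, x) ◁ q)) (h ((k, x) :: u) hu)
  | unit => exact realizes_lift_of_eq (conj_unit (eps k) q) (h u hu)
  | act l s ih =>
    exact realizes_lift_of_eq
      (conj_whiskerRight_comp (gamma k l (k * l) rfl s) q (nf (k * l) s w) (nf (k * l) s w'))
      (ih h (k * l) u hu)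
  | mul s t ih ih' =>
    simp only [GTree.size] at hu
    -- The factor `t` is adjacent to `q` and is treated first, behind contexts lengthened by the
    -- size of `s`.
    exact realizes_lift_of_eq
      (conj_tensor (Groupoid.inv (beta k s t)) q (nf k t w) (nf k t w') (nf k s (normal k t w))
        (nf k s (normal k t w')))
      (ih (p := u.length + GTree.size s) (fun u' hu' => ih' h k u' (by omega)) k u rfl)

end TreeGroupoid
end GBraid

/-! ### Realization of the structural isomorphisms -/

namespace GBraid
open GTree PreHom BraidGroup
open MonoidalCategory

section
theorem inv_comp_comp_eq_id {C : Type*} [Groupoid C] {p q z : C} {f : p ⟶ z} {k : p ⟶ q}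
    {f' : q ⟶ z} (h : k ≫ f' = f) : inv f ≫ k ≫ f' = 𝟙 z := by rw [h, IsIso.inv_hom_id]

variable {C : Type*} [Groupoid C] [MonoidalCategory C]

/-- On normal forms a product of morphisms is the right factor behind the old left input, followed
by the left factor in front of the new normal form. -/
theorem nf_natural_tensor {z z' a a' b b' v n m n' l l' : C} (c : z ⟶ a ⊗ b) (K : z ⟶ z')
    (c' : z' ⟶ a' ⊗ b') (F : a ⟶ a') (F' : b ⟶ b') (h : K ≫ c' = c ≫ (F ⊗ₘ F'))
    (fb : b ⊗ v ⟶ n) (fb' : b' ⊗ v ⟶ n') (fa : a ⊗ n ⟶ m) (fa₁ : a ⊗ n' ⟶ l)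
    (fa' : a' ⊗ n' ⟶ l') :
    inv (c ▷ v ≫ (α_ a b v).hom ≫ a ◁ fb ≫ fa) ≫ K ▷ v ≫ c' ▷ v ≫ (α_ a' b' v).hom ≫
        a' ◁ fb' ≫ fa' =
      (inv fa ≫ a ◁ (inv fb ≫ F' ▷ v ≫ fb') ≫ fa₁) ≫ inv fa₁ ≫ F ▷ n' ≫ fa' := by
  rw [← comp_whiskerRight_assoc, h, IsIso.inv_comp_eq]
  simp only [Category.assoc, IsIso.hom_inv_id_assoc, ← MonoidalCategory.whiskerLeft_comp_assoc]
  simp only [tensorHom_def', comp_whiskerRight, Category.assoc, MonoidalCategory.whiskerLeft_comp,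
    associator_naturality_left_assoc]
  rw [← whisker_exchange_assoc]
  simp

theorem nf_natural_act {a a' b b' v n n' : C} (K : a ⟶ a') (F : b ⟶ b') (c : a ⟶ b) (c' : a' ⟶ b')
    (h : K ≫ c' = c ≫ F) (f : b ⊗ v ⟶ n) (f' : b' ⊗ v ⟶ n') :
    inv (c ▷ v ≫ f) ≫ K ▷ v ≫ c' ▷ v ≫ f' = inv f ≫ F ▷ v ≫ f' := by
  rw [← comp_whiskerRight_assoc, h, IsIso.inv_comp_eq]
  simp

/-- In this and the next three lemmas a structural isomorphism `K` becomes the identity on normal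
forms, given its compatibility `h` with the isomorphisms from which the normal form is built. -/
theorem nf_associator {z z' s t u st tu v n m l : C} (K : z ⟶ z') (b₁ : z ⟶ st ⊗ u)
    (b₂ : st ⟶ s ⊗ t) (b₃ : z' ⟶ s ⊗ tu) (b₄ : tu ⟶ t ⊗ u)
    (h : K ≫ b₃ ≫ s ◁ b₄ = b₁ ≫ b₂ ▷ u ≫ (α_ s t u).hom)
    (f : u ⊗ v ⟶ n) (f' : t ⊗ n ⟶ m) (f'' : s ⊗ m ⟶ l) :
    K ▷ v ≫ b₃ ▷ v ≫ (α_ _ _ _).hom ≫ s ◁ (b₄ ▷ v ≫ (α_ _ _ _).hom ≫ t ◁ f ≫ f') ≫ f'' =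
      b₁ ▷ v ≫ (α_ _ _ _).hom ≫ st ◁ f ≫ b₂ ▷ n ≫ (α_ _ _ _).hom ≫ s ◁ f' ≫ f'' := by
  rw [whisker_exchange_assoc]
  calc _ = (K ≫ b₃ ≫ s ◁ b₄) ▷ v ≫ (α_ _ _ _).hom ≫ s ◁ (α_ _ _ _).hom ≫ s ◁ t ◁ f ≫
      s ◁ f' ≫ f'' := by simp
    _ = _ := by rw [h]; simp

theorem nf_leftUnitor {z s e v n : C} (K : z ⟶ s) (b : z ⟶ e ⊗ s) (i : e ⟶ 𝟙_ C)
    (h : K = b ≫ i ▷ s ≫ (λ_ s).hom) (f : s ⊗ v ⟶ n) :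
    K ▷ v ≫ f = b ▷ v ≫ (α_ _ _ _).hom ≫ e ◁ f ≫ i ▷ n ≫ (λ_ n).hom := by
  rw [h, whisker_exchange_assoc]
  simp

theorem nf_rightUnitor {z s e v n : C} (K : z ⟶ s) (b : z ⟶ s ⊗ e) (i : e ⟶ 𝟙_ C)
    (h : K = b ≫ s ◁ i ≫ (ρ_ s).hom) (f : s ⊗ v ⟶ n) :
    K ▷ v ≫ f = b ▷ v ≫ (α_ _ _ _).hom ≫ s ◁ (i ▷ v ≫ (λ_ v).hom) ≫ f := by
  rw [h]
  simp

theorem nf_tensor_act {z z' s t s' t' v n m : C} (K : z ⟶ z') (b : z ⟶ s ⊗ t) (b' : z' ⟶ s' ⊗ t')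
    (c : s ⟶ s') (d : t ⟶ t') (h : K ≫ b' = b ≫ (c ⊗ₘ d)) (f : t' ⊗ v ⟶ n) (f' : s' ⊗ n ⟶ m) :
    K ▷ v ≫ b' ▷ v ≫ (α_ _ _ _).hom ≫ s' ◁ f ≫ f' =
      b ▷ v ≫ (α_ _ _ _).hom ≫ s ◁ (d ▷ v ≫ f) ≫ c ▷ n ≫ f' := by
  rw [← comp_whiskerRight_assoc, h, MonoidalCategory.tensorHom_def, whisker_exchange_assoc]
  simp

theorem whiskerRight_comp_eq {a b b' v n : C} {f : a ⟶ b} {f' : a ⟶ b'} {d : b ⟶ b'} (h : f ≫ d = f')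
    (k : b' ⊗ v ⟶ n) : f ▷ v ≫ d ▷ v ≫ k = f' ▷ v ≫ k := by
  rw [← comp_whiskerRight_assoc, h]

end

variable {G : Type u} [Group G] {X : Type v} {g : X → G}

namespace TreeGroupoid

variable (r : ℕ)

/-- The formal morphism `f` acts on words as its underlying braid on `r` strands does. -/
def IsRealized {s t : TreeGroupoid g} (f : PreHom g s t) : Prop :=
  ∀ (k : G) (u v : List (G × X)), Realizes (f.toBraid r u.length) (lift u (nfMap k v (mk f)))

variable {r}

namespace IsRealized

/-- Equal classes have equal braids, the bound in `Rel.toBraid_eq` coming from the length `r` of the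
word. Hence it suffices to realize any one expression of a morphism. -/
theorem of_mk_eq {s t : TreeGroupoid g} {f f' : PreHom g s t} (hf : IsRealized r f)
    (h : mk f' = mk f) : IsRealized r f' := by
  intro k u v hw
  have := (mk_eq_iff.1 h).toBraid_eq (r := r) u.length (by
    rw [length_plug, length_normal] at hw; omega)
  rw [this, h]
  exact hf k u v hw

theorem comp {s t q : TreeGroupoid g} {f : PreHom g s t} {f' : PreHom g t q}
    (hf : IsRealized r f) (hf' : IsRealized r f') : IsRealized r (PreHom.comp f f') := by
  intro k u v
  have : nfMap k v (mk (PreHom.comp f f')) = nfMap k v (mk f) ≫ nfMap k v (mk f') := by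
    simp [nfMap, mk_comp]
  rw [this, lift_comp]
  exact (hf k u v).comp (hf' k u v)

theorem inv {s t : TreeGroupoid g} {f : PreHom g s t} (hf : IsRealized r f) :
    IsRealized r (PreHom.inv f) := by
  intro k u v
  have h : nfMap k v (mk f) ≫ nfMap k v (mk (PreHom.inv f)) = 𝟙 _ := by
    simp [nfMap, mk_inv]
  have : lift u (nfMap k v (mk (PreHom.inv f))) =
      CategoryTheory.inv (lift u (nfMap k v (mk f))) := by
    rw [← IsIso.inv_eq_inv, IsIso.inv_inv]
    refine IsIso.inv_eq_of_inv_hom_id ?_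
    rw [← lift_comp, h, lift_id]
  rw [this]
  refine (hf k u v).inv ?_
  have := f.size_eq
  rw [length_plug, length_plug, length_normal, length_normal, this]

theorem actMap (h : G) {s t : TreeGroupoid g} {f : PreHom g s t} (hf : IsRealized r f) :
    IsRealized r (s := TreeGroupoid.act h s) (t := TreeGroupoid.act h t) (PreHom.actMap h f) :=
  fun k u v => realizes_lift_of_eq (nf_natural_act (amap k (amap h (mk f))) (amap (k * h) (mk f))
    (gamma k h (k * h) rfl s) (gamma k h (k * h) rfl t) (gamma_nat _ _ _ _ _)
    (nf (k * h) s v) (nf (k * h) t v)) (hf (k * h) u v)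

theorem mulMap {s t s' t' : TreeGroupoid g} {f : PreHom g s t} {f' : PreHom g s' t'}
    (hf : IsRealized r f) (hf' : IsRealized r f') :
    IsRealized r (s := s ⊗ s') (t := t ⊗ t') (PreHom.mulMap f f') := fun k u v =>
  realizes_lift_of_eq (nf_natural_tensor (Groupoid.inv (beta k s s')) (amap k (mk f ⊗ₘ mk f'))
      (Groupoid.inv (beta k t t')) (amap k (mk f)) (amap k (mk f'))
      (by rw [Groupoid.inv_eq_inv, Groupoid.inv_eq_inv, IsIso.comp_inv_eq, Category.assoc,
        beta_nat, IsIso.inv_hom_id_assoc]) (nf k s' v) (nf k t' v) (nf k s (normal k s' v))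
      (nf k s (normal k t' v)) (nf k t (normal k t' v))) (Realizes.lift_comp
    (realizes_lift_whiskerLeft (p := u.length + GTree.size s)
      (fun u' hu' => hu' ▸ hf' k u' v) k s u rfl) (hf k u (normal k t' v)))

theorem of_nf_eq {s t : TreeGroupoid g} {f : PreHom g s t} (hb : ∀ p, f.toBraid r p = 1)
    (h : ∀ k v, (⟨normal k s v, 𝟙 _⟩ : PointedWord g (wordObj g (normal k s v))) =
      ⟨normal k t v, nfMap k v (mk f)⟩) : IsRealized r f := fun k u v => by
  rw [hb]
  exact realizes_one_lift u (h k v)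

theorem id (s : TreeGroupoid g) : IsRealized r (PreHom.id s) :=
  of_nf_eq (fun _ => rfl) fun k v => PointedWord.mk_congr (by
    change 𝟙 _ = nfMap k v (𝟙 s)
    simp [nfMap])

theorem alpha (s t u : TreeGroupoid g) :
    IsRealized r (s := (s ⊗ t) ⊗ u) (t := s ⊗ t ⊗ u) (PreHom.alpha s t u) :=
  of_nf_eq (fun _ => rfl) fun k v => PointedWord.mk_congr (inv_comp_comp_eq_id
    (nf_associator (amap k (α_ s t u).hom) (Groupoid.inv (beta k (s ⊗ t) u))
      (Groupoid.inv (beta k s t)) (Groupoid.inv (beta k s (t ⊗ u))) (Groupoid.inv (beta k t u))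
      (by
        have := beta_assoc s t u k
        simp only [Groupoid.inv_eq_inv]
        rw [IsIso.eq_inv_comp, ← cancel_epi (beta k s t ▷ act k u), reassoc_of% this]
        simp [← comp_whiskerRight_assoc, ← MonoidalCategory.whiskerLeft_comp])
      (nf k u v) (nf k t (normal k u v)) (nf k s (normal k t (normal k u v))))).symm

theorem ell (s : TreeGroupoid g) : IsRealized r (s := 𝟙_ _ ⊗ s) (t := s) (PreHom.ell s) :=
  of_nf_eq (fun _ => rfl) fun k v => PointedWord.mk_congr (inv_comp_comp_eq_id
    (nf_leftUnitor (amap k (λ_ s).hom) (Groupoid.inv (beta k (𝟙_ _) s)) (eps k)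
      (by rw [eps_leftUnitor, Groupoid.inv_eq_inv, IsIso.inv_hom_id_assoc]) (nf k s v))).symm

theorem rho (s : TreeGroupoid g) : IsRealized r (s := s ⊗ 𝟙_ _) (t := s) (PreHom.rho s) :=
  of_nf_eq (fun _ => rfl) fun k v => PointedWord.mk_congr (inv_comp_comp_eq_id
    (nf_rightUnitor (amap k (ρ_ s).hom) (Groupoid.inv (beta k s (𝟙_ _))) (eps k)
      (by rw [eps_rightUnitor, Groupoid.inv_eq_inv, IsIso.inv_hom_id_assoc]) (nf k s v))).symm

theorem beta (h : G) (s t : TreeGroupoid g) :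
    IsRealized r (s := TreeGroupoid.act h s ⊗ TreeGroupoid.act h t)
      (t := TreeGroupoid.act h (s ⊗ t)) (PreHom.beta h s t) :=
  of_nf_eq (fun _ => rfl) fun k v => PointedWord.mk_congr (inv_comp_comp_eq_id
    ((congrArg (_ ≫ ·) (whiskerRight_comp_eq rfl _)).trans
    (nf_tensor_act (amap k (TreeGroupoid.beta h s t))
      (Groupoid.inv (TreeGroupoid.beta k (act h s) (act h t)))
      (gamma k h (k * h) rfl (s ⊗ t) ≫ Groupoid.inv (TreeGroupoid.beta (k * h) s t))
      (gamma k h (k * h) rfl s) (gamma k h (k * h) rfl t)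
      (by
        rw [Groupoid.inv_eq_inv, Groupoid.inv_eq_inv, IsIso.eq_inv_comp, ← Category.assoc,
          ← Category.assoc, IsIso.comp_inv_eq, Category.assoc, gamma_beta])
      (nf (k * h) t v) (nf (k * h) s (normal (k * h) t v))))).symm

theorem gamma (a b l : G) (hl : a * b = l) (s : TreeGroupoid g) :
    IsRealized r (s := TreeGroupoid.act a (TreeGroupoid.act b s)) (t := TreeGroupoid.act l s)
      (PreHom.gamma a b l hl s) := by
  refine of_nf_eq (fun _ => rfl) fun k v => ?_
  -- The normal forms carry the labels `k * a * b` and `k * l`, equal but not by definition; the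
  -- variable `m` lets one be substituted for the other.
  have key : ∀ m (hm : k * l = m), k * a * b = m →
      (⟨normal (k * a * b) s v, 𝟙 _⟩ : PointedWord g (wordObj g (normal (k * a * b) s v))) =
      ⟨normal m s v, CategoryTheory.inv (TreeGroupoid.gamma k a (k * a) rfl (act b s) ▷ wordObj g v ≫
          TreeGroupoid.gamma (k * a) b (k * a * b) rfl s ▷ wordObj g v ≫ nf (k * a * b) s v) ≫
        amap k (TreeGroupoid.gamma a b l hl s) ▷ wordObj g v ≫
        TreeGroupoid.gamma k l m hm s ▷ wordObj g v ≫ nf m s v⟩ := by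
    rintro m hm rfl
    refine PointedWord.mk_congr (inv_comp_comp_eq_id ?_).symm
    rw [← comp_whiskerRight_assoc, ← comp_whiskerRight_assoc,
      gamma_gamma s k a b (k * a) l (k * a * b) rfl hl rfl hm]
  exact key (k * l) rfl (by rw [mul_assoc, hl])

theorem delta (s : TreeGroupoid g) :
    IsRealized r (s := TreeGroupoid.act 1 s) (t := s) (PreHom.delta s) := by
  refine of_nf_eq (fun _ => rfl) fun k v => ?_
  have key : ∀ m (hm : k * 1 = m), m = k →
      (⟨normal m s v, 𝟙 _⟩ : PointedWord g (wordObj g (normal m s v))) =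
      ⟨normal k s v, CategoryTheory.inv (TreeGroupoid.gamma k 1 m hm s ▷ wordObj g v ≫ nf m s v) ≫
        amap k (TreeGroupoid.delta s) ▷ wordObj g v ≫ nf k s v⟩ := by
    rintro m hm rfl
    refine PointedWord.mk_congr (inv_comp_comp_eq_id ?_).symm
    rw [gamma_one_right]
  exact key (k * 1) rfl (mul_one k)

theorem eps (h : G) : IsRealized r (s := TreeGroupoid.act h (𝟙_ (TreeGroupoid g)))
    (t := 𝟙_ (TreeGroupoid g)) (PreHom.eps h) :=
  of_nf_eq (fun _ => rfl) fun k v => PointedWord.mk_congr (inv_comp_comp_eq_id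
    ((whiskerRight_comp_eq rfl _).trans ((congrArg (fun f => f ▷ _ ≫ (λ_ (wordObj g v)).hom)
      (gamma_eps k h (k * h) rfl).symm).trans (whiskerRight_comp_eq rfl _).symm))).symm

end IsRealized
end TreeGroupoid
end GBraid

/-! ### Realization of the braiding -/

namespace GBraid
open GTree PreHom BraidGroup
open MonoidalCategory

theorem nf_crossTail {C : Type*} [Groupoid C] [MonoidalCategory C] {z z' s s' t t' v : C}
    (K : z ⟶ z') (b : z ⟶ s ⊗ t) (b' : z' ⟶ t' ⊗ s) (c : s ⟶ s') {t'' : C} (d : t' ⟶ t'')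
    (S : s' ⊗ t ⟶ t'' ⊗ s') (h : K ≫ b' ≫ (d ⊗ₘ c) = b ≫ c ▷ t ≫ S) :
    crossTail S v = inv (b ▷ v ≫ (α_ _ _ _).hom ≫ s ◁ 𝟙 _ ≫ c ▷ (t ⊗ v) ≫ 𝟙 _) ≫ K ▷ v ≫
      b' ▷ v ≫ (α_ _ _ _).hom ≫ t' ◁ (c ▷ v ≫ 𝟙 _) ≫ d ▷ (s' ⊗ v) ≫ 𝟙 _ := by
  rw [IsIso.eq_inv_comp]
  calc _ = (b ≫ c ▷ t ≫ S) ▷ v ≫ (α_ _ _ _).hom := by simp [crossTail]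
    _ = _ := by rw [← h, tensorHom_def']; simp

variable {G : Type u} [Group G] {X : Type v} {g : X → G}

namespace TreeGroupoid

theorem amap_braid (h : G) (s t : TreeGroupoid g) (a b l : G) (ha : s.col = a)
    (hb : (act h s).col = b) (hl : h * a = l) (hl' : b * h = l) :
    amap h (braid s t a ha) = inv (beta h s t) ≫ braid (act h s) (act h t) b hb ≫
      gamma b h l hl' t ▷ act h s ≫ inv (gamma h a l hl t) ▷ act h s ≫ beta h (act a t) s := by
  rw [← reassoc_of% beta_braid s t h a b l ha hb hl hl']
  simp

variable {r : ℕ}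

namespace IsRealized

/-- Naturality conjugates the braiding into that of isomorphic inputs by morphisms already realized.
-/
theorem braid_of_iso {s s' t t' : TreeGroupoid g} {f : PreHom g s s'} {f' : PreHom g t t'}
    {a : G} (ha : s.col = a) (ha' : s'.col = a) (hf : IsRealized r f) (hf' : IsRealized r f')
    (H : IsRealized r (PreHom.braid s' t' a ha')) : IsRealized r (PreHom.braid s t a ha) := by
  refine (((hf.mulMap hf').comp H).comp ((hf'.actMap a).mulMap hf).inv).of_mk_eq ?_
  have : TreeGroupoid.braid s t a ha = (mk f ⊗ₘ mk f') ≫ TreeGroupoid.braid s' t' a ha' ≫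
      Groupoid.inv (amap a (mk f') ⊗ₘ mk f) := by
    rw [Groupoid.inv_eq_inv, ← Category.assoc, IsIso.eq_comp_inv, braid_nat _ _ a ha ha']
  refine this.trans ?_
  rw [← Category.assoc]
  rfl

/-- The first hexagon solved for the braiding of the product. The hypothesis on `s` covers all
second inputs because `s` meets `u` only after `u` has received the colour of `t` as a label. -/
theorem braid_tensor_left {s t u : TreeGroupoid g} (hs : ∀ u a ha, IsRealized r
      (PreHom.braid (g := g) s u a ha))
    (ht : ∀ a ha, IsRealized r (PreHom.braid (g := g) t u a ha)) (c : G) (hc : (s ⊗ t).col = c) :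
    IsRealized r (PreHom.braid (g := g) (GTree.mul s t) u c hc) := by
  refine ((((((alpha s t u).comp ((id s).mulMap (ht _ rfl))).comp
    (alpha s (TreeGroupoid.act t.col u) t).inv).comp
    ((hs (TreeGroupoid.act t.col u) _ rfl).mulMap (id t))).comp
    (((gamma s.col t.col c hc u).mulMap (id s)).mulMap (id t))).comp
    (alpha (TreeGroupoid.act c u) s t)).of_mk_eq ?_
  have := TreeGroupoid.braid_tensor_left s t u s.col t.col c rfl rfl hc hc
  rw [Iso.comp_inv_eq] at this
  refine this.trans ?_
  simp only [← Category.assoc]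
  rfl

theorem braid_tensor_right {s t u : TreeGroupoid g} (a : G) (ha : s.col = a)
    (ht : IsRealized r (PreHom.braid (g := g) s t a ha))
    (hu : IsRealized r (PreHom.braid (g := g) s u a ha)) :
    IsRealized r (PreHom.braid (g := g) s (GTree.mul t u) a ha) := by
  refine ((((((alpha s t u).inv.comp (ht.mulMap (id u))).comp
    (alpha (TreeGroupoid.act a t) s u)).comp ((id (TreeGroupoid.act a t)).mulMap hu)).comp
    (alpha (TreeGroupoid.act a t) (TreeGroupoid.act a u) s).inv).comp
    ((beta a t u).mulMap (id s))).of_mk_eq ?_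
  have h := TreeGroupoid.braid_tensor_right s t u a ha
  have : TreeGroupoid.braid s (t ⊗ u) a ha = (α_ s t u).inv ≫ TreeGroupoid.braid s t a ha ▷ u ≫
      (α_ (TreeGroupoid.act a t) s u).hom ≫ TreeGroupoid.act a t ◁ TreeGroupoid.braid s u a ha ≫
      (α_ _ _ _).inv ≫ TreeGroupoid.beta a t u ▷ s := by
    rw [← reassoc_of% h]
    simp
  refine this.trans ?_
  simp only [← Category.assoc]
  rfl

/-- G9, solved for the braiding of the two `[h]`-images. -/
theorem braid_act_act {s t : TreeGroupoid g} (h : G) (b : G) (hb : (TreeGroupoid.act h s).col = b)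
    (H : ∀ a ha, IsRealized r (PreHom.braid (g := g) s t a ha)) :
    IsRealized r (PreHom.braid (g := g) (TreeGroupoid.act h s) (TreeGroupoid.act h t) b hb) := by
  have hl : b * h = h * s.col := by rw [← hb]; simp
  refine (((((beta h s t).comp ((H s.col rfl).actMap h)).comp
    (beta h (TreeGroupoid.act s.col t) s).inv).comp
    ((gamma h s.col _ rfl t).mulMap (id (TreeGroupoid.act h s)))).comp
    ((gamma b h _ hl t).mulMap (id (TreeGroupoid.act h s))).inv).of_mk_eq ?_
  have := beta_braid s t h s.col b _ rfl hb rfl hl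
  rw [mk_comp, mk_inv, IsIso.eq_comp_inv]
  refine this.symm.trans ?_
  rw [← Groupoid.inv_eq_inv]
  simp only [← Category.assoc]
  rfl

theorem braid_unit_left (t : TreeGroupoid g) (a : G) (ha : (𝟙_ (TreeGroupoid g)).col = a) :
    IsRealized r (PreHom.braid (𝟙_ (TreeGroupoid g)) t a ha) := by
  obtain rfl : 1 = a := ha
  refine (((ell t).comp (delta t).inv).comp (rho (TreeGroupoid.act 1 t)).inv).of_mk_eq ?_
  refine (TreeGroupoid.braid_unit_left t).trans ?_
  rw [← Groupoid.inv_eq_inv, ← Category.assoc]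
  rfl

theorem braid_unit_right (s : TreeGroupoid g) (a : G) (ha : s.col = a) :
    IsRealized r (PreHom.braid s (𝟙_ (TreeGroupoid g)) a ha) := by
  refine (((rho s).comp (ell s).inv).comp ((eps a).inv.mulMap (id s))).of_mk_eq ?_
  refine (TreeGroupoid.braid_unit_right s a ha).trans ?_
  rw [← Groupoid.inv_eq_inv, ← Category.assoc]
  rfl

/-- In a context with label `k` the inputs become the letters `(k * h, x)` and `(k, y)`. By G9 for
`[k]` and naturality of the braiding in `γ`, the braiding becomes their crossing. -/
theorem braid_leaf_leaf (h : G) (x y : X) (a : G)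
    (ha : (TreeGroupoid.act h (GTree.leaf x : GTree G X) : TreeGroupoid g).col = a) :
    IsRealized r (PreHom.braid (g := g) (TreeGroupoid.act h (GTree.leaf x : GTree G X))
      (GTree.leaf y : GTree G X) a ha) := by
  intro k u v
  have hb : toBraid r u.length (PreHom.braid (g := g) (TreeGroupoid.act h (GTree.leaf x : GTree G X))
      (GTree.leaf y : GTree G X) a ha) = gen r u.length := block_one_one _
  rw [hb]
  refine realizes_gen_lift u (w := (k * h, x) :: (k, y) :: v) (by simp) ?_
  have key : ∀ (lx ly : TreeGroupoid g) (hlx : (act h lx).col = a) (A : G)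
      (hA : (act (k * h) lx).col = A) (hA' : A * k = k * a),
      amap k (TreeGroupoid.braid (act h lx) ly a hlx) ≫
        Groupoid.inv (TreeGroupoid.beta k (act a ly) (act h lx)) ≫
          (TreeGroupoid.gamma k a (k * a) rfl ly ⊗ₘ TreeGroupoid.gamma k h (k * h) rfl lx) =
        Groupoid.inv (TreeGroupoid.beta k (act h lx) ly) ≫
          TreeGroupoid.gamma k h (k * h) rfl lx ▷ act k ly ≫
            swap (act (k * h) lx) ly A k (k * a) hA hA' := by
    intro lx ly hlx A hA hA'
    have hA₁ : (act k (act h lx)).col = A := by rw [← hA]; simp [mul_assoc]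
    have := braid_nat (TreeGroupoid.gamma k h (k * h) rfl lx) (𝟙 (act k ly)) A hA₁ hA
    rw [amap_id, tensorHom_id, id_tensorHom] at this
    rw [swap, reassoc_of% this, amap_braid k _ ly a A (k * a) hlx hA₁ rfl hA']
    simp [Groupoid.inv_eq_inv, tensorHom_def', whisker_exchange]
  -- The crossing labels `y` with the colour of `(k * h, x)` times `k`, the normal form with `k *
  -- a`; `ha` identifies the two.
  have key₂ : ∀ m (hm : letterColor g (k * h, x) * k = m), k * a = m →
      (⟨wordStep g 0 ((k * h, x) :: (k, y) :: v), cross 0 ((k * h, x) :: (k, y) :: v)⟩ :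
        PointedWord g (wordObj g ((k * h, x) :: (k, y) :: v))) =
      ⟨(k * a, y) :: (k * h, x) :: v, nfMap k v (TreeGroupoid.braid (TreeGroupoid.act h (GTree.leaf x : GTree G X))
        (GTree.leaf y : GTree G X) a ha)⟩ := by
    rintro m hm rfl
    have h1 : (⟨wordStep g 0 ((k * h, x) :: (k, y) :: v), cross 0 ((k * h, x) :: (k, y) :: v)⟩ :
        PointedWord g (wordObj g ((k * h, x) :: (k, y) :: v))) = ⟨(k * a, y) :: (k * h, x) :: v,
          crossTail (letterSwap g (k * h, x) (k, y) (k * a) hm) (wordObj g v)⟩ := by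
      have : ∀ m (hm' : letterColor g (k * h, x) * k = m), m = k * a →
        (⟨(m, y) :: (k * h, x) :: v,
          crossTail (letterSwap g (k * h, x) (k, y) m hm') (wordObj g v)⟩ :
        PointedWord g (wordObj g ((k * h, x) :: (k, y) :: v))) = ⟨(k * a, y) :: (k * h, x) :: v,
          crossTail (letterSwap g (k * h, x) (k, y) (k * a) hm) (wordObj g v)⟩ := by
        rintro _ _ rfl; rfl
      exact this _ rfl hm
    refine h1.trans (PointedWord.mk_congr ?_)
    exact nf_crossTail _ _ _ (TreeGroupoid.gamma k h (k * h) rfl (GTree.leaf x : GTree G X))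
      (TreeGroupoid.gamma k a (k * a) rfl (GTree.leaf y : GTree G X)) _
      (key (GTree.leaf x : GTree G X) (GTree.leaf y : GTree G X) ha _ rfl hm)
  refine key₂ _ rfl ?_
  rw [← ha]
  simp [letterColor, mul_assoc, col, TreeGroupoid.act, GTree.color]

/-- The label `h` stays arbitrary in the induction on `t`: facing `[l]t`, the leaf is rewritten as
`[l][l⁻¹ * h]x`, and `[l]` is pulled out of both inputs. -/
theorem braid_act_leaf (h : G) (x : X) (t : TreeGroupoid g) (a : G)
    (ha : (TreeGroupoid.act h (GTree.leaf x : GTree G X) : TreeGroupoid g).col = a) :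
    IsRealized r (PreHom.braid (g := g) (TreeGroupoid.act h (GTree.leaf x : GTree G X)) t a ha) := by
  induction t generalizing h a with
  | leaf y => exact braid_leaf_leaf h x y a ha
  | unit => exact braid_unit_right _ a ha
  | act l t ih =>
    have hc : (TreeGroupoid.act l (TreeGroupoid.act (l⁻¹ * h) (GTree.leaf x : GTree G X)) :
        TreeGroupoid g).col = a := by
      rw [← ha]
      change l * (l⁻¹ * h * g x * (l⁻¹ * h)⁻¹) * l⁻¹ = h * g x * h⁻¹
      simp [mul_assoc]
    exact braid_of_iso ha hc (gamma l (l⁻¹ * h) h (by simp) (GTree.leaf x : GTree G X)).inv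
      (id (TreeGroupoid.act l t)) (braid_act_act l a hc fun b hb => ih (l⁻¹ * h) b hb)
  | mul t t' ih ih' => exact braid_tensor_right a ha (ih h a ha) (ih' h a ha)

theorem braid (s t : TreeGroupoid g) (a : G) (ha : s.col = a) :
    IsRealized r (PreHom.braid s t a ha) := by
  induction s generalizing t a with
  | leaf x =>
    have hc : (TreeGroupoid.act 1 (GTree.leaf x : GTree G X) : TreeGroupoid g).col = a := by
      rw [← ha]
      change 1 * g x * 1⁻¹ = g x
      simp
    exact braid_of_iso ha hc (delta (GTree.leaf x : GTree G X)).inv (id t)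
      (braid_act_leaf 1 x t a hc)
  | unit => exact braid_unit_left t a ha
  | act h s ih =>
    -- Since `t` is isomorphic to `[h][h⁻¹]t`, the label `[h]` can be pulled out of both inputs.
    exact braid_of_iso ha ha (id (TreeGroupoid.act h s))
      ((delta t).inv.comp (gamma h h⁻¹ 1 (by simp) t).inv)
      (braid_act_act h a ha fun b hb => ih _ b hb)
  | mul s s' ih ih' =>
    exact braid_tensor_left (fun u b hb => ih u b hb) (fun b hb => ih' t b hb) a ha

end IsRealized

/-- Every formal morphism acts on words as its underlying braid does. -/
theorem isRealized {s t : TreeGroupoid g} (f : PreHom g s t) : IsRealized r f := by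
  induction f with
  | id s => exact .id s
  | comp _ _ ih ih' => exact ih.comp ih'
  | inv _ ih => exact ih.inv
  | actMap h _ ih => exact ih.actMap h
  | mulMap _ _ ih ih' => exact ih.mulMap ih'
  | alpha s t u => exact .alpha s t u
  | ell s => exact .ell s
  | rho s => exact .rho s
  | braid s t a ha => exact .braid s t a ha
  | beta h s t => exact .beta h s t
  | gamma k h l hl s => exact .gamma k h l hl s
  | delta s => exact .delta s
  | eps h => exact .eps h

end TreeGroupoid
end GBraid

namespace GBraid
open GTree PreHom BraidGroup
open MonoidalCategory

variable {G : Type u} [Group G] {r : ℕ} {h : G} {g : Fin r → G}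

/-! ### Words and the set `Σ_r ×_h G^r` -/

/-- The word of an element of `Σ_r × G^r`. -/
def toWord {G : Type u} (x : Equiv.Perm (Fin r) × (Fin r → G)) : List (G × Fin r) :=
  List.ofFn fun p => (x.2 p, x.1⁻¹ p)

@[simp]
theorem length_toWord {G : Type u} (x : Equiv.Perm (Fin r) × (Fin r → G)) :
    (toWord x).length = r := by
  simp [toWord]

theorem toWord_injective {G : Type u} : Function.Injective (toWord (G := G) (r := r)) := by
  rintro ⟨σ, b⟩ ⟨σ', b'⟩ H
  have H' := List.ofFn_injective H
  have h1 : b = b' := funext fun p => congrArg Prod.fst (congrFun H' p)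
  have h2 : σ⁻¹ = σ'⁻¹ := Equiv.ext fun p => congrArg Prod.snd (congrFun H' p)
  rw [h1, inv_injective h2]

theorem getElem_wordStep {X : Type v} (g : X → G) (j : ℕ) (w : List (G × X))
    (hj : j + 1 < w.length) (i : ℕ) (hi : i < (wordStep g j w).length) (hi' : i < w.length) :
    (wordStep g j w)[i] = if i = j then (letterColor g w[j] * w[j + 1].1, w[j + 1].2)
      else if i = j + 1 then w[j] else w[i] := by
  fun_induction wordStep g j w generalizing i with
  | case1 a b w => rcases i with _ | _ | i <;> simp
  | case2 j a w ih =>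
    rcases i with _ | i
    · simp
    · simp only [List.length_cons, Nat.add_lt_add_iff_right] at hj hi hi'
      simpa using ih hj i hi hi'
  | case3 j w h1 h2 =>
    rcases j with _ | j <;> rcases w with _ | ⟨a, _ | ⟨b, w⟩⟩ <;>
      first
      | (simp only [List.length_cons, List.length_nil] at hj; omega)
      | simp_all

theorem wordStep_toWord (j : Fin (r - 1)) (x : Equiv.Perm (Fin r) × (Fin r → G)) :
    wordStep g j (toWord x) = toWord (braidStep g j x) := by
  have hj : (j : ℕ) + 1 < r := by omega
  refine List.ext_getElem (by simp) fun i h1 h2 => ?_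
  have hi : i < r := by simpa using h2
  rw [getElem_wordStep g j (toWord x) (by simpa using hj) i h1 (by simpa using hi)]
  simp only [toWord, List.getElem_ofFn]
  have e1 : (⟨i, hi⟩ : Fin r) = lo j ↔ i = j := by simp [lo, Fin.ext_iff]
  have e2 : (⟨i, hi⟩ : Fin r) = GBraid.hi j ↔ i = j + 1 := by simp [GBraid.hi, Fin.ext_iff]
  simp only [braidStep, mul_inv_rev, Equiv.Perm.mul_apply, Equiv.swap_inv, e1, e2]
  split_ifs with h3 h4
  · rw [e1.2 h3, Equiv.swap_apply_left]; rfl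
  · rw [e2.2 h4, Equiv.swap_apply_right]; rfl
  · rw [Equiv.swap_apply_of_ne_of_ne (mt e1.1 h3) (mt e2.1 h4)]

theorem exists_toWord_eq {G : Type u} (w : List (G × Fin r)) (hw : (w.map Prod.snd).Nodup)
    (hw' : ∀ x, x ∈ w.map Prod.snd) : ∃ x, toWord x = w := by
  have hl : w.length = r := by
    have := List.toFinset_card_of_nodup hw
    rw [List.length_map, Finset.eq_univ_iff_forall.2 fun x => List.mem_toFinset.2 (hw' x),
      Finset.card_univ, Fintype.card_fin] at this
    exact this.symm
  have hinj : Function.Injective fun p : Fin r => (w[(p : ℕ)]'(lt_of_lt_of_eq p.2 hl.symm)).2 := by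
    intro p q hpq
    have := (List.nodup_iff_injective_get.1 hw)
      (a₁ := ⟨p, by simp [hl]⟩) (a₂ := ⟨q, by simp [hl]⟩) (by simpa using hpq)
    simpa [Fin.ext_iff] using this
  refine ⟨((Equiv.ofBijective _ (Finite.injective_iff_bijective.1 hinj))⁻¹,
    fun p => (w[(p : ℕ)]'(lt_of_lt_of_eq p.2 hl.symm)).1), ?_⟩
  refine List.ext_getElem (by simp [toWord, hl]) fun i h1 h2 => ?_
  simp [toWord]

theorem map_snd_nfWord (k : G) (t : GTree G (Fin r)) (v : List (G × Fin r)) :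
    (nfWord k t v).map Prod.snd = t.leaves ++ v.map Prod.snd := by
  induction t generalizing k v with
  | leaf => rfl
  | unit => rfl
  | act h t ih => exact ih _ _
  | mul s t ih ih' => simp [nfWord, ih, ih', leaves]

/-- Conjugation is multiplicative, so distributing labels to the leaves preserves the colour. This
puts normal forms in `SigmaSet h g`. -/
theorem prod_letterColor_nfWord (k : G) (t : GTree G (Fin r)) (v : List (G × Fin r)) :
    ((nfWord k t v).map (letterColor g)).prod =
      k * t.color g * k⁻¹ * (v.map (letterColor g)).prod := by
  induction t generalizing k v with
  | leaf => simp [nfWord, letterColor, color]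
  | unit => simp [nfWord, color]
  | act h t ih => simp [nfWord, ih, color, mul_assoc]
  | mul s t ih ih' => simp [nfWord, ih, ih', color, mul_assoc]

theorem map_letterColor_toWord (x : Equiv.Perm (Fin r) × (Fin r → G)) :
    (toWord x).map (letterColor g) = List.ofFn (posColor g x) := by
  rw [toWord, List.map_ofFn]
  rfl

theorem nfWord_wordTree (w v : List (G × Fin r)) : nfWord 1 (wordTree w) v = w ++ v := by
  induction w with
  | nil => rfl
  | cons a w ih => simp [wordTree, nfWord, ih]

theorem GTree.size_eq_length_leaves {G : Type u} (t : GTree G (Fin r)) :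
    t.size = t.leaves.length := by
  induction t with
  | leaf => rfl
  | unit => rfl
  | act h t ih => exact ih
  | mul s t ih ih' => simp [GTree.size, leaves, ih, ih']

namespace PBr

theorem size_tree (s : PBr h g) : s.tree.size = r := by
  rw [size_eq_length_leaves, ← List.toFinset_card_of_nodup s.isLinear.1,
    Finset.eq_univ_iff_forall.2 fun x => List.mem_toFinset.2 (s.isLinear.2 x), Finset.card_univ,
    Fintype.card_fin]

theorem exists_toWord_eq (s : PBr h g) :
    ∃ x : SigmaSet h g, toWord x.1 = nfWord 1 s.tree [] := by
  obtain ⟨x, hx⟩ := GBraid.exists_toWord_eq (nfWord 1 s.tree [])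
    (by simpa [map_snd_nfWord] using s.isLinear.1) (by simpa [map_snd_nfWord] using s.isLinear.2)
  refine ⟨⟨x, ?_⟩, hx⟩
  rw [← map_letterColor_toWord, hx, prod_letterColor_nfWord, s.color_eq]
  simp

/-- The element of `Σ_r ×_h G^r` given by the normal form of an operation. -/
noncomputable def toSigma (s : PBr h g) : SigmaSet h g := (exists_toWord_eq s).choose

theorem toWord_toSigma (s : PBr h g) : toWord s.toSigma.1 = nfWord 1 s.tree [] :=
  (exists_toWord_eq s).choose_spec

/-- The standard operation of an element of `Σ_r ×_h G^r`. -/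
def ofSigma (x : SigmaSet h g) : PBr h g where
  tree := wordTree (toWord x.1)
  color_eq := by
    have := prod_letterColor_nfWord (g := g) 1 (wordTree (toWord x.1)) []
    rw [nfWord_wordTree, List.append_nil, map_letterColor_toWord, x.2] at this
    simpa using this.symm
  isLinear := by
    have := map_snd_nfWord 1 (wordTree (toWord x.1)) []
    rw [nfWord_wordTree, List.append_nil, List.map_nil, List.append_nil] at this
    rw [IsLinear, ← this, toWord, List.map_ofFn]
    refine ⟨List.nodup_ofFn.2 x.1.1⁻¹.injective, fun y => (List.mem_ofFn' _ _).2 ?_⟩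
    exact x.1.1⁻¹.surjective y

theorem toSigma_ofSigma (x : SigmaSet h g) : (ofSigma x).toSigma = x :=
  Subtype.ext (toWord_injective ((toWord_toSigma _).trans
    ((nfWord_wordTree _ _).trans (List.append_nil _))))

end PBr

theorem braidGroup_induction {P : BraidGroup r → Prop} (b : BraidGroup r) (one : P 1)
    (of : ∀ j : Fin (r - 1), P (PresentedGroup.of j))
    (inv : ∀ j : Fin (r - 1), P (PresentedGroup.of j)⁻¹) (mul : ∀ b b', P b → P b' → P (b * b')) :
    P b := by
  induction b using PresentedGroup.induction_on with
  | _ z =>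
    induction z using FreeGroup.induction_on with
    | C1 => exact one
    | of j => exact of j
    | inv_of j _ => exact inv j
    | mul x y hx hy => exact mul _ _ hx hy

theorem gen_eq_of (j : Fin (r - 1)) : gen r j = PresentedGroup.of j := by
  rw [gen, dif_pos j.2]

/-! ### Braids determine morphisms, and every admissible braid occurs -/

open TreeGroupoid

/-- Forgetting the morphism of a pointed word leaves the action on `SigmaSet`. For inverse
generators this follows from the injectivity of `wordStep`. -/
theorem word_braidAct {o : TreeGroupoid g} (b : BraidGroup r)
    (e : {e : PointedWord g o // e.word.length = r}) (x : SigmaSet h g)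
    (hx : e.1.word = toWord x.1) :
    (PointedWord.braidAct o r b e).1.word = toWord (b • x).1 := by
  have hof : ∀ (j : Fin (r - 1)) (e : {e : PointedWord g o // e.word.length = r})
      (x : SigmaSet h g), wordStep g j (toWord x.1) = toWord ((PresentedGroup.of j : BraidGroup r) • x).1 ∧
        (PointedWord.braidAct o r (PresentedGroup.of j) e).1.word = wordStep g j e.1.word := by
    intro j e x
    rw [of_smul_val, wordStep_toWord, ← gen_eq_of, PointedWord.braidAct_gen (by omega)]
    exact ⟨rfl, rfl⟩
  induction b using braidGroup_induction generalizing e x with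
  | one => simpa using hx
  | of j => rw [(hof j e x).2, hx, (hof j e x).1]
  | inv j =>
    have h1 := (hof j (PointedWord.braidAct o r (PresentedGroup.of j)⁻¹ e) x).2
    rw [← Equiv.Perm.mul_apply, ← map_mul, mul_inv_cancel, map_one, Equiv.Perm.one_apply, hx] at h1
    have h2 := (hof j e ((PresentedGroup.of j : BraidGroup r)⁻¹ • x)).1
    rw [smul_inv_smul, h1] at h2
    rw [← wordStepInv_wordStep (g := g) j (toWord _), h2, wordStepInv_wordStep]
  | mul b b' ih ih' =>
    rw [map_mul, Equiv.Perm.mul_apply, mul_smul]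
    exact ih _ _ (ih' _ _ hx)

theorem toBraid_smul {s t : PBr h g} (f : PreHom g s.tree t.tree) :
    f.toBraid r 0 • s.toSigma = t.toSigma := by
  have hl : (normal (g := g) 1 s.tree []).length = r :=
    (length_nfWord 1 s.tree []).trans (by rw [List.length_nil, add_zero, s.size_tree])
  have h1 := isRealized (r := r) (s := s.tree) (t := t.tree) f 1 [] [] hl _ (𝟙 _)
  refine Subtype.ext (toWord_injective ?_)
  rw [← word_braidAct _ ⟨⟨_, 𝟙 _⟩, hl⟩ s.toSigma s.toWord_toSigma.symm, t.toWord_toSigma]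
  exact congrArg PointedWord.word h1

/-- Both morphisms describe the action of the same braid on the normal form with its identity, so
their effects on normal forms coincide. -/
theorem rel_of_toBraid_eq {s t : PBr h g} {f f' : PreHom g s.tree t.tree}
    (H : f.toBraid r 0 = f'.toBraid r 0) : Rel g f f' := by
  have hl : (normal (g := g) 1 s.tree []).length = r :=
    (length_nfWord 1 s.tree []).trans (by rw [List.length_nil, add_zero, s.size_tree])
  have h1 := isRealized (r := r) (s := s.tree) (t := t.tree) f 1 [] [] hl _ (𝟙 _)
  have h2 := isRealized (r := r) (s := s.tree) (t := t.tree) f' 1 [] [] hl _ (𝟙 _)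
  -- `nfMap 1 []` conjugates `[1]F` tensored with the unit by isomorphisms; `[1]` is faithful by
  -- naturality of `δ`, and tensoring with the unit is faithful.
  have h3 : ∀ {s t : TreeGroupoid g} {F F' : s ⟶ t}, nfMap 1 [] F = nfMap 1 [] F' → F = F' := by
    intro s t F F' h
    rw [nfMap, nfMap, cancel_epi, cancel_mono] at h
    have h4 : F ▷ 𝟙_ (TreeGroupoid g) = F' ▷ 𝟙_ (TreeGroupoid g) := by
      rw [← cancel_epi (delta s ▷ 𝟙_ (TreeGroupoid g)), ← comp_whiskerRight, ← comp_whiskerRight,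
        ← delta_nat, ← delta_nat, comp_whiskerRight, comp_whiskerRight]
      exact congrArg (· ≫ _) h
    exact (whiskerRight_iff _ _).1 h4
  refine mk_eq_iff.1 (h3 (s := s.tree) (t := t.tree) ?_)
  have h5 := PointedWord.hom_eq_of_mk_eq (h1.symm.trans
    ((congrArg (fun b => (PointedWord.braidAct _ r b ⟨⟨_, 𝟙 _⟩, hl⟩).1) H).trans h2))
  rw [Category.id_comp, Category.id_comp] at h5
  exact h5

/-- Every braid is the underlying braid of a formal morphism starting at a given word. -/
theorem exists_toBraid_eq (b : BraidGroup r) (w : List (G × Fin r)) (hw : w.length = r) :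
    ∃ (w' : List (G × Fin r)) (f : PreHom g (wordTree w) (wordTree w')), f.toBraid r 0 = b := by
  induction b using braidGroup_induction generalizing w with
  | one => exact ⟨w, .id _, rfl⟩
  | of j =>
    refine ⟨_, crossing g j w, ?_⟩
    rw [toBraid_crossing j 0 w (by omega), zero_add, gen_eq_of]
  | inv j =>
    obtain ⟨w, rfl⟩ : ∃ w', wordStep g j w' = w := ⟨_, wordStep_wordStepInv j.1 w⟩
    rw [length_wordStep] at hw
    refine ⟨_, .inv (crossing g j w), ?_⟩
    rw [toBraid, toBraid_crossing j 0 w (by omega), zero_add, gen_eq_of]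
  | mul b b' ih ih' =>
    obtain ⟨w', f', rfl⟩ := ih' w hw
    have hw' : w'.length = r := by
      rw [← size_wordTree, ← f'.size_eq, size_wordTree, hw]
    obtain ⟨w'', f, rfl⟩ := ih w' hw'
    exact ⟨w'', .comp f' f, rfl⟩

/-- The formal morphism from an operation to its normal form. -/
def PBr.toNormal (s : PBr h g) : PreHom g s.tree (wordTree (nfWord 1 s.tree [])) :=
  .inv (.delta _) ⋙ₚ .inv (.rho _) ⋙ₚ nfHom g 1 s.tree []

theorem PBr.toBraid_toNormal (s : PBr h g) : s.toNormal.toBraid r 0 = 1 := by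
  change ((nfHom g 1 s.tree []).toBraid r 0 * 1⁻¹) * 1⁻¹ = 1
  rw [toBraid_nfHom, inv_one, mul_one, mul_one]

theorem exists_toBraid_eq_of_smul_eq {s t : PBr h g} (b : BraidGroup r)
    (hb : b • s.toSigma = t.toSigma) : ∃ f : PreHom g s.tree t.tree, f.toBraid r 0 = b := by
  have hl : (nfWord 1 s.tree []).length = r := by
    rw [length_nfWord, List.length_nil, add_zero, PBr.size_tree]
  obtain ⟨w', f, hf⟩ := exists_toBraid_eq (g := g) b (nfWord 1 s.tree []) hl
  have hl' : (normal (g := g) 1 (wordTree (nfWord 1 s.tree [])) []).length = r :=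
    (congrArg List.length ((nfWord_wordTree _ _).trans (List.append_nil _))).trans hl
  have h1 := isRealized (r := r) (s := wordTree (nfWord 1 s.tree [])) (t := wordTree w') f 1 [] []
    hl' _ (𝟙 _)
  have h2 : normal (g := g) 1 (wordTree w') [] = toWord (b • s.toSigma).1 := by
    rw [← word_braidAct b ⟨⟨_, 𝟙 (wordObj g _)⟩, hl'⟩ s.toSigma
      (s.toWord_toSigma.trans ((nfWord_wordTree _ _).trans (List.append_nil _)).symm).symm, ← hf]
    exact (congrArg PointedWord.word h1).symm
  rw [hb, t.toWord_toSigma] at h2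
  -- The crossings choose their own target word, but it must be the word of `b • s.toSigma`, hence
  -- of `t.toSigma`.
  obtain rfl : w' = nfWord 1 t.tree [] :=
    ((nfWord_wordTree _ _).trans (List.append_nil _)).symm.trans h2
  refine ⟨s.toNormal ⋙ₚ f ⋙ₚ .inv t.toNormal, ?_⟩
  simp only [toBraid, PBr.toBraid_toNormal, hf, inv_one, one_mul, mul_one]

/-! ### The equivalence -/

/-- The braid of a morphism between operations. -/
def PBr.homBraid {s t : PBr h g} (f : s ⟶ t) : BraidGroup r :=
  Quot.lift (fun f : PreHom g s.tree t.tree => f.toBraid r 0)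
    (fun _ _ H => H.toBraid_eq 0 (by rw [s.size_tree, zero_add])) f

theorem PBr.homBraid_smul {s t : PBr h g} (f : s ⟶ t) : PBr.homBraid f • s.toSigma = t.toSigma :=
  Quot.inductionOn f fun f => toBraid_smul f

/-- The functor sending a morphism of operations to its braid. -/
noncomputable def braidFunctor (h : G) (g : Fin r → G) :
    PBr h g ⥤ ActionCategory (BraidGroup r) (SigmaSet h g) where
  obj s := ⟨(), s.toSigma⟩
  map f := ⟨PBr.homBraid f, PBr.homBraid_smul f⟩
  map_id _ := Subtype.ext rfl
  map_comp f f' := Subtype.ext (Quot.inductionOn f fun _ => Quot.inductionOn f' fun _ => rfl)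

instance : (braidFunctor h g).Faithful where
  map_injective {s t f f'} H := by
    have H' : PBr.homBraid f = PBr.homBraid f' := congrArg Subtype.val H
    induction f using Quot.inductionOn with | _ f =>
    induction f' using Quot.inductionOn with | _ f' =>
    exact Quot.sound (rel_of_toBraid_eq H')

instance : (braidFunctor h g).Full where
  map_surjective {s t} := by
    rintro ⟨b, hb⟩
    obtain ⟨f, hf⟩ := exists_toBraid_eq_of_smul_eq (s := s) (t := t) b hb
    exact ⟨Quot.mk _ f, Subtype.ext hf⟩

instance : (braidFunctor h g).EssSurj where
  mem_essImage := by
    rintro ⟨⟨⟩, x⟩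
    refine ⟨PBr.ofSigma x, ⟨eqToIso ?_⟩⟩
    exact congrArg (fun x => (⟨(), x⟩ : ActionCategory (BraidGroup r) (SigmaSet h g)))
      (PBr.toSigma_ofSigma x)

instance : (braidFunctor h g).IsEquivalence where

end GBraid

theorem mainTheorem6 {G : Type u} [Group G] {r : ℕ} (h : G) (g : Fin r → G) :
    Nonempty (GBraid.PBr h g ≌ ActionCategory (GBraid.BraidGroup r) (GBraid.SigmaSet h g)) :=
  ⟨(GBraid.braidFunctor h g).asEquivalence⟩
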